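/- Let $M$ be a compact smooth Riemannian manifold (without boundary), let $X$ be a $C^1$ vector field on $M$ with flow $\phi_t$, and let $\Phi_t=d\phi_t:TM\to TM$ be the tangent flow. A point $x$ is a singularity if $X(x)=0$ and regular otherwise. For a regular point $x$ put $\mathcal N_x=\{v\in T_xM:\langle v,X(x)\rangle=0\}$ and, for $v\in\mathcal N_x$ and $t\in\mathbb R$, $$\psi_t(v)=\Phi_t(v)-\frac{\langle\Phi_t(v),X(\phi_t(x))\rangle}{|X(\phi_t(x))|^2}X(\phi_t(x)),\qquad \psi^*_t(v)=\frac{|X(x)|}{|X(\phi_t(x))|}\,\psi_t(v),$$ so that $\psi^*_t(x):=\psi^*_t|_{\mathcal N_x}$ is a linear map $\mathcal N_x\to\mathcal N_{\phi_t(x)}$, with operator norm $\|\psi^*_t(x)\|$. For $C,\eta,T>0$, a regular point $x$ is called $(C,\eta,T)$-$\psi^*$-contracted if there are times $0=t_0<t_1<\cdots<t_n<\cdots$ with $t_i-t_{i-1}\le T$ for all $i\geq 1$, $\lim_{n\to\infty}t_n=\infty$, and $$\prod_{i=1}^n\|\psi^*_{t_i-t_{i-1}}(\phi_{t_{i-1}}(x))\|\le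 Ce^{-\eta t_n}\quad\text{for all } n\ge1.$$ A dominated splitting at a singularity $\sigma$ is a direct sum decomposition $T_\sigma M=E\oplus F$ into $\Phi_t$-invariant subspaces for which there are $K,\lambda>0$ with $$|\Phi_t(v)|\,|w|\le Ke^{-\lambda t}\,|v|\,|\Phi_t(w)|\quad\text{for all } t\ge0,\ v\in E,\ w\in F$$ ($E=\{0\}$ is allowed; it occurs when $\dim M=1$). **Proposition.** Let $C,\eta,T>0$, let $\sigma$ be a singularity of $X$, and let $(x_n)$ be a sequence of $(C,\eta,T)$-$\psi^*$-contracted points of $M$ with $\lim_{n\to\infty}x_n=\sigma$. Then there is a dominated splitting $T_\sigma M=E\oplus F$ with respect to the tangent flow $\Phi_t$ such that $\dim F=1$ and no accumulation point in $TM$ of the sequence of unit vectors $X(x_n)/|X(x_n)|$ lies in $E$. -/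

import Mathlib

open Filter Topology Bundle
open scoped Manifold ContDiff

noncomputable section

namespace VectorFieldFlow

section Flow

variable {E : Type*} [NormedAddCommGroup E] [NormedSpace ℝ E]
  {M : Type*} [TopologicalSpace M] [ChartedSpace E M]

open Classical in
/-- The flow `φ_t` of a vector field `X`: the curve `t ↦ φ_t(x)` is the integral curve of `X`
through `x` at time `0`. For a `C^1` vector field on a compact boundaryless Hausdorff manifold such
a curve exists (`exists_integralCurve` below) and is unique, so that the default value `x`
is never taken. -/
def flow (X : (x : M) → TangentSpace 𝓘(ℝ, E) x) (t : ℝ) (x : M) : M :=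
  if h : ∃ γ : ℝ → M, γ 0 = x ∧ IsMIntegralCurve (I := 𝓘(ℝ, E)) γ X then h.choose t else x

/-- The tangent flow `Φ_t = d φ_t`, at the point `x`. -/
def tangentFlow (X : (x : M) → TangentSpace 𝓘(ℝ, E) x) (t : ℝ) (x : M) :
    TangentSpace 𝓘(ℝ, E) x →L[ℝ] TangentSpace 𝓘(ℝ, E) (flow X t x) :=
  mfderiv 𝓘(ℝ, E) 𝓘(ℝ, E) (flow X t) x

theorem exists_integralCurve_local [CompleteSpace E] [IsManifold 𝓘(ℝ, E) 1 M]
    {X : (x : M) → TangentSpace 𝓘(ℝ, E) x}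
    (hX : ContMDiff 𝓘(ℝ, E) 𝓘(ℝ, E).tangent 1
      (fun x => (⟨x, X x⟩ : TangentBundle 𝓘(ℝ, E) M))) (x₀ : M) :
    ∃ ε > (0 : ℝ), ∀ᶠ x in 𝓝 x₀, ∃ γ : ℝ → M, γ 0 = x ∧
      IsMIntegralCurveOn (I := 𝓘(ℝ, E)) γ X (Set.Ioo (-ε) ε) := by
  let I := 𝓘(ℝ, E)
  have hv := contMDiffAt_iff.1 (hX x₀)
  obtain ⟨ε, hε, a, r, L, K, hr, hpl⟩ := IsPicardLindelof.of_contDiffAt_one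
    (hv.2.contDiffAt (range_mem_nhds_isInteriorPoint
      (BoundarylessManifold.isInteriorPoint (I := I) (x := x₀)))).snd
  obtain ⟨α, hα, hαc⟩ := (hpl 0).exists_forall_mem_closedBall_eq_hasDerivWithinAt_continuousOn
  set e := extChartAt I x₀ with he
  have hx₀ : e x₀ ∈ Metric.closedBall (e x₀) r := Metric.mem_closedBall_self (le_of_lt hr)
  have hcont : ContinuousAt α (e x₀, 0) := by
    apply hαc.continuousAt
    exact prod_mem_nhds (Metric.closedBall_mem_nhds _ hr) (Icc_mem_nhds (by linarith) (by linarith))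
  have hopen : IsOpen e.target := isOpen_extChartAt_target x₀
  have htgt : ∀ᶠ p in 𝓝 (e x₀, (0 : ℝ)), α p ∈ e.target := by
    apply hcont.eventually_mem
    rw [(hα _ hx₀).1]
    exact hopen.mem_nhds (mem_extChartAt_target x₀)
  rw [nhds_prod_eq] at htgt
  obtain ⟨p, hp, q, hq, hpq⟩ := eventually_prod_iff.1 htgt
  obtain ⟨δ, hδ, hδq⟩ := Metric.eventually_nhds_iff_ball.1 hq
  refine ⟨min ε δ, lt_min hε hδ, ?_⟩
  have hce : ContinuousAt e x₀ := continuousAt_extChartAt x₀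
  filter_upwards [hce.eventually hp, hce.eventually_mem (Metric.closedBall_mem_nhds (e x₀) hr),
    extChartAt_source_mem_nhds (I := I) x₀] with x hxp hxr hxs
  obtain ⟨h0, hder⟩ := hα _ hxr
  refine ⟨e.symm ∘ fun t => α (e x, t), ?_, ?_⟩
  · simp only [Function.comp_apply, h0]
    exact e.left_inv hxs
  intro t ht
  have htε : t ∈ Set.Ioo (0 - ε) (0 + ε) :=
    ⟨by linarith [ht.1, min_le_left ε δ], by linarith [ht.2, min_le_left ε δ]⟩
  have htδ : t ∈ Metric.ball (0 : ℝ) δ := by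
    rw [Real.ball_eq_Ioo]
    exact ⟨by linarith [ht.1, min_le_right ε δ], by linarith [ht.2, min_le_right ε δ]⟩
  have hf3' : α (e x, t) ∈ e.target := hpq hxp (hδq t htδ)
  let f : ℝ → E := fun t => α (e x, t)
  let xₜ : M := e.symm (f t)
  have h : HasDerivAt f (fderivWithin ℝ (extChartAt I x₀ ∘ (extChartAt I xₜ).symm)
      (Set.range I) (extChartAt I xₜ xₜ) (X xₜ)) t :=
    (hder t (Set.Ioo_subset_Icc_self htε)).hasDerivAt (Icc_mem_nhds htε.1 htε.2)
  rw [← tangentCoordChange_def] at h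
  have hft1 := Set.mem_preimage.mp <|
    Set.mem_of_mem_of_subset hf3' (extChartAt I x₀).target_subset_preimage_source
  have hft2 := mem_extChartAt_source (I := I) xₜ
  let w : E := X xₜ
  have hw : tangentCoordChange I x₀ xₜ xₜ (tangentCoordChange I xₜ x₀ xₜ w) = w := by
    rw [tangentCoordChange_comp ⟨⟨hft2, hft1⟩, hft2⟩, tangentCoordChange_self hft2]
  have key : HasDerivAt ((extChartAt I xₜ ∘ e.symm) ∘ f) w t := by
    rw [← hw]
    apply HasFDerivAt.comp_hasDerivAt _ _ h
    apply HasFDerivWithinAt.hasFDerivAt (s := Set.range I) _ (by simp [I])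
    have hri : e (e.symm (f t)) = f t := e.right_inv hf3'
    rw [← hri]
    exact hasFDerivWithinAt_tangentCoordChange ⟨hft1, hft2⟩
  have hc1 : ContinuousAt e.symm (f t) := continuousAt_extChartAt_symm'' hf3'
  have hc2 : ContinuousAt f t := h.continuousAt
  have hc : ContinuousAt (e.symm ∘ f) t := hc1.comp hc2
  apply HasMFDerivAt.hasMFDerivWithinAt
  refine ⟨hc, ?_⟩
  exact key.hasFDerivAt.hasFDerivWithinAt

/-- On a compact boundaryless manifold, a `C^1` vector field is complete. -/
theorem exists_integralCurve [CompleteSpace E] [IsManifold 𝓘(ℝ, E) 1 M] [T2Space M]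
    [CompactSpace M] {X : (x : M) → TangentSpace 𝓘(ℝ, E) x}
    (hX : ContMDiff 𝓘(ℝ, E) 𝓘(ℝ, E).tangent 1
      (fun x => (⟨x, X x⟩ : TangentBundle 𝓘(ℝ, E) M))) (x : M) :
    ∃ γ : ℝ → M, γ 0 = x ∧ IsMIntegralCurve (I := 𝓘(ℝ, E)) γ X := by
  choose ε hε h using exists_integralCurve_local hX
  obtain ⟨s, hs⟩ := CompactSpace.elim_nhds_subcover _ h
  obtain ⟨δ, hδ, hδs⟩ : ∃ δ > (0 : ℝ), ∀ y ∈ s, δ ≤ ε y := by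
    rcases s.eq_empty_or_nonempty with rfl | hne
    · exact ⟨1, one_pos, by simp⟩
    · obtain ⟨y, hy, hmin⟩ := s.exists_min_image ε hne
      exact ⟨ε y, hε y, hmin⟩
  refine exists_isMIntegralCurve_of_isMIntegralCurveOn hX hδ (fun z => ?_) x
  have hz : z ∈ (⊤ : Set M) := trivial
  rw [← hs] at hz
  simp only [Set.mem_iUnion] at hz
  obtain ⟨y, hy, γ, h0, hγ⟩ := hz
  exact ⟨γ, h0, hγ.mono (Set.Ioo_subset_Ioo (neg_le_neg (hδs y hy)) (hδs y hy))⟩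

theorem flow_spec [CompleteSpace E] [IsManifold 𝓘(ℝ, E) 1 M] [T2Space M]
    [CompactSpace M] {X : (x : M) → TangentSpace 𝓘(ℝ, E) x}
    (hX : ContMDiff 𝓘(ℝ, E) 𝓘(ℝ, E).tangent 1
      (fun x => (⟨x, X x⟩ : TangentBundle 𝓘(ℝ, E) M))) (x : M) :
    flow X 0 x = x ∧ IsMIntegralCurve (I := 𝓘(ℝ, E)) (fun t => flow X t x) X := by
  have h := exists_integralCurve hX x
  simp only [flow, dif_pos h]
  exact h.choose_spec

end Flow

section Poincare

variable {E : Type*} [NormedAddCommGroup E] [NormedSpace ℝ E]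
  {M : Type*} [TopologicalSpace M] [ChartedSpace E M]
  [RiemannianBundle (fun x : M => TangentSpace 𝓘(ℝ, E) x)]

/-- The normal space `N_x = {v ∈ T_x M : ⟨v, X(x)⟩ = 0}`. -/
def normalSpace (X : (x : M) → TangentSpace 𝓘(ℝ, E) x) (x : M) :
    Submodule ℝ (TangentSpace 𝓘(ℝ, E) x) where
  carrier := {v | inner ℝ v (X x) = 0}
  add_mem' := by
    intro v w hv hw
    simp only [Set.mem_ofPred_eq] at hv hw ⊢
    rw [inner_add_left, hv, hw, add_zero]
  zero_mem' := by simp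
  smul_mem' := by
    intro c v hv
    simp only [Set.mem_ofPred_eq] at hv ⊢
    rw [inner_smul_left, hv, mul_zero]

/-- The map `v ↦ Φ_t(v) - (⟨Φ_t(v), X(φ_t(x))⟩ / |X(φ_t(x))|²) X(φ_t(x))` on `T_x M`. -/
def projectedTangentFlow (X : (x : M) → TangentSpace 𝓘(ℝ, E) x) (t : ℝ) (x : M) :
    TangentSpace 𝓘(ℝ, E) x →L[ℝ] TangentSpace 𝓘(ℝ, E) (flow X t x) :=
  tangentFlow X t x -
    ((‖X (flow X t x)‖ ^ 2)⁻¹ • (innerSL ℝ (X (flow X t x)) ∘L tangentFlow X t x)).smulRight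
      (X (flow X t x))

theorem projectedTangentFlow_apply (X : (x : M) → TangentSpace 𝓘(ℝ, E) x) (t : ℝ) (x : M)
    (v : TangentSpace 𝓘(ℝ, E) x) :
    projectedTangentFlow X t x v = tangentFlow X t x v -
      (inner ℝ (tangentFlow X t x v) (X (flow X t x)) / ‖X (flow X t x)‖ ^ 2) •
        X (flow X t x) := by
  simp [projectedTangentFlow, real_inner_comm, div_eq_inv_mul]

theorem projectedTangentFlow_mem (X : (x : M) → TangentSpace 𝓘(ℝ, E) x) (t : ℝ) (x : M)
    (v : TangentSpace 𝓘(ℝ, E) x) :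
    projectedTangentFlow X t x v ∈ normalSpace X (flow X t x) := by
  change inner ℝ (projectedTangentFlow X t x v) (X (flow X t x)) = 0
  rw [projectedTangentFlow_apply, inner_sub_left, real_inner_smul_left, real_inner_self_eq_norm_sq]
  rcases eq_or_ne (X (flow X t x)) 0 with h | h
  · simp [h]
  · have : ‖X (flow X t x)‖ ^ 2 ≠ 0 := by simpa using h
    rw [div_mul_cancel₀ _ this, sub_self]

/-- The linear Poincaré flow `ψ_t : N_x → N_{φ_t(x)}`, at a regular point `x`. -/
def linearPoincareFlow (X : (x : M) → TangentSpace 𝓘(ℝ, E) x) (t : ℝ) (x : M) :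
    normalSpace X x →L[ℝ] normalSpace X (flow X t x) :=
  (projectedTangentFlow X t x ∘L (normalSpace X x).subtypeL).codRestrict
    (normalSpace X (flow X t x)) (fun v => projectedTangentFlow_mem X t x v)

/-- The rescaled linear Poincaré flow `ψ*_t = (|X(x)| / |X(φ_t(x))|) ψ_t`, at a regular point. -/
def rescaledPoincareFlow (X : (x : M) → TangentSpace 𝓘(ℝ, E) x) (t : ℝ) (x : M) :
    normalSpace X x →L[ℝ] normalSpace X (flow X t x) :=
  (‖X x‖ / ‖X (flow X t x)‖) • linearPoincareFlow X t x

/-- The point `x` is regular and `(C, η, T)`-`ψ*`-contracted. -/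
def IsContracted (X : (x : M) → TangentSpace 𝓘(ℝ, E) x) (C η T : ℝ) (x : M) : Prop :=
  X x ≠ 0 ∧ ∃ τ : ℕ → ℝ, τ 0 = 0 ∧ StrictMono τ ∧ (∀ i, τ (i + 1) - τ i ≤ T) ∧
    Tendsto τ atTop atTop ∧
    ∀ n, 1 ≤ n → ∏ i ∈ Finset.range n,
      ‖rescaledPoincareFlow X (τ (i + 1) - τ i) (flow X (τ i) x)‖ ≤ C * Real.exp (-η * τ n)

/-- `T_Λ M = V ⊕ W` is a dominated splitting for the tangent flow of `X` over the `φ`-invariant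
set `Λ` (only the values of `V` and `W` at points of `Λ` matter): the splitting is `Φ_t`-invariant
and `‖Φ_t|V(x)‖ ≤ K e^{-λ t} m(Φ_t|W(x))` for all `x ∈ Λ` and `t ≥ 0`, where `‖·‖` is the largest
and `m(·)` the smallest expansion factor. The norm inequality is written on vectors. -/
structure IsDominatedSplitting (X : (x : M) → TangentSpace 𝓘(ℝ, E) x) (Λ : Set M)
    (V W : (x : M) → Submodule ℝ (TangentSpace 𝓘(ℝ, E) x)) : Prop where
  isCompl : ∀ x ∈ Λ, IsCompl (V x) (W x)
  map_fst : ∀ x ∈ Λ, ∀ t : ℝ, (V x).map (tangentFlow X t x).toLinearMap = V (flow X t x)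
  map_snd : ∀ x ∈ Λ, ∀ t : ℝ, (W x).map (tangentFlow X t x).toLinearMap = W (flow X t x)
  dominated : ∃ K > (0 : ℝ), ∃ lam > (0 : ℝ), ∀ x ∈ Λ, ∀ t : ℝ, 0 ≤ t →
    ∀ v ∈ V x, ∀ w ∈ W x,
      ‖tangentFlow X t x v‖ * ‖w‖ ≤ K * Real.exp (-lam * t) * (‖v‖ * ‖tangentFlow X t x w‖)

end Poincare

end VectorFieldFlow

end

/-! Write `d = X(x)/|X(x)|` at a contracted point `x`. Since `Φ_t` carries `X` to `X`, one has `Φ_t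
d = X(φ_t x)/|X(x)|`, so the rescaling in `ψ*` is exactly division by `|Φ_t d|`. Multiplying the
contraction factors along the times `t_i` therefore says that every `Φ_t v` is within `B e^{-ηt}
|Φ_t d| |v|` of the line `ℝ Φ_t d`, with `B` independent of `t` and of `x` near `σ`
(`exists_contractsBy_exp`). For a fixed `t` this is a closed condition on `(x, d)`. It passes to the
limit at `σ`: each limit direction `u` of `X(x_n)/|X(x_n)|` spans a line attracting all vectors at
rate `η` under the linear flow at `σ` (`exists_isAttractingLine`).

The rest is linear algebra. The coefficients of `Φ_n v` along `Φ_n u` form a Cauchy sequence, and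
subtracting the limiting multiple of `u` from `v` leaves a vector that decays relatively to `u`.
These slow vectors form an invariant hyperplane `E` not containing `u`. Modulo `E`, `Φ_1` is
multiplication by some `m ≠ 0`, so `Φ_1 - m` has its range in `E` and hence a kernel vector `w`. As
`|Φ_n u|` is at most of order `|m|^n`, slow vectors decay relatively to `w`; this gives `w ∉ E` and
the domination with `F = ℝ w` (`exists_dominated_complement`). A second limit direction `u'`
attracts `u`, so `|Φ_n u|` is at most a constant times `|Φ_n u'|` and `u'` cannot be slow
(`notMem_slowSubmodule_of_isAttractingLine`).

Near `σ`, the differentiability and uniform estimates for the flow come from a cut-off field in a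
chart (`exists_isLocalFlowModel`). Only bounded times matter for each estimate, so points close
enough to `σ` do not leave the chart. -/

noncomputable section

namespace VectorFieldFlow

/-! ### Linear flows with an attracting line -/

section LinearFlow

variable {V : Type*} [NormedAddCommGroup V] [NormedSpace ℝ V]

/-- A locally bounded one-parameter group of continuous linear maps. -/
structure IsLinearFlow (Φ : ℝ → V →L[ℝ] V) : Prop where
  zero : ∀ v, Φ 0 v = v
  add : ∀ s t v, Φ (s + t) v = Φ s (Φ t v)
  bdd : ∃ κ : ℝ, ∀ s, |s| ≤ 1 → ‖Φ s‖ ≤ κ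

/-- Every vector is attracted, at rate `η`, by the moving line spanned by `Φ_t u`. -/
def IsAttractingLine (Φ : ℝ → V →L[ℝ] V) (K η : ℝ) (u : V) : Prop :=
  ∀ t : ℝ, 0 ≤ t → ∀ v, ∃ c : ℝ, ‖Φ t v - c • Φ t u‖ ≤ K * Real.exp (-η * t) * ‖Φ t u‖ * ‖v‖

/-- The vectors whose orbit decays, at rate `η`, relatively to the orbit of `u`. -/
def slowSubmodule (Φ : ℝ → V →L[ℝ] V) (η : ℝ) (u : V) : Submodule ℝ V where
  carrier := {v | ∃ K : ℝ, ∀ n : ℕ, ‖Φ n v‖ ≤ K * Real.exp (-η * n) * ‖Φ n u‖}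
  add_mem' := by
    rintro v w ⟨K, hK⟩ ⟨L, hL⟩
    refine ⟨K + L, fun n => ?_⟩
    rw [map_add]
    refine (norm_add_le _ _).trans ?_
    linarith [hK n, hL n]
  zero_mem' := ⟨0, fun n => by simp⟩
  smul_mem' := by
    rintro c v ⟨K, hK⟩
    refine ⟨|c| * K, fun n => ?_⟩
    rw [map_smul, norm_smul, Real.norm_eq_abs]
    nlinarith [hK n, abs_nonneg c]

variable {Φ : ℝ → V →L[ℝ] V} {K η : ℝ} {u : V}

namespace IsLinearFlow

theorem comm (hΦ : IsLinearFlow Φ) (s t : ℝ) (v : V) : Φ s (Φ t v) = Φ t (Φ s v) := by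
  rw [← hΦ.add, ← hΦ.add, add_comm]

theorem neg_apply (hΦ : IsLinearFlow Φ) (t : ℝ) (v : V) : Φ (-t) (Φ t v) = v := by
  rw [← hΦ.add, neg_add_cancel, hΦ.zero]

theorem apply_neg (hΦ : IsLinearFlow Φ) (t : ℝ) (v : V) : Φ t (Φ (-t) v) = v := by
  rw [← hΦ.add, add_neg_cancel, hΦ.zero]

theorem apply_ne_zero (hΦ : IsLinearFlow Φ) (t : ℝ) {v : V} (hv : v ≠ 0) : Φ t v ≠ 0 := by
  intro h
  have := hΦ.neg_apply t v
  rw [h, map_zero] at this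
  exact hv this.symm

theorem exists_bound (hΦ : IsLinearFlow Φ) :
    ∃ κ : ℝ, 0 < κ ∧ ∀ s, |s| ≤ 1 → ∀ v, ‖Φ s v‖ ≤ κ * ‖v‖ := by
  obtain ⟨κ, hκ⟩ := hΦ.bdd
  refine ⟨max κ 1, lt_max_of_lt_right one_pos, fun s hs v => ?_⟩
  exact (Φ s).le_of_opNorm_le ((hκ s hs).trans (le_max_left _ _)) v

theorem map_mem_slowSubmodule (hΦ : IsLinearFlow Φ) (s : ℝ) {v : V}
    (hv : v ∈ slowSubmodule Φ η u) : Φ s v ∈ slowSubmodule Φ η u := by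
  obtain ⟨K, hK⟩ := hv
  refine ⟨‖Φ s‖ * K, fun n => ?_⟩
  rw [hΦ.comm]
  refine ((Φ s).le_opNorm _).trans ?_
  have := mul_le_mul_of_nonneg_left (hK n) (norm_nonneg (Φ s))
  linarith

theorem map_slowSubmodule (hΦ : IsLinearFlow Φ) (s : ℝ) :
    (slowSubmodule Φ η u).map (Φ s).toLinearMap = slowSubmodule Φ η u := by
  apply le_antisymm
  · rintro _ ⟨v, hv, rfl⟩
    exact hΦ.map_mem_slowSubmodule s hv
  · intro v hv
    exact ⟨Φ (-s) v, hΦ.map_mem_slowSubmodule (-s) hv, hΦ.apply_neg s v⟩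

theorem tendsto_exp_neg_mul_nat (hη : 0 < η) :
    Tendsto (fun n : ℕ => Real.exp (-η * n)) atTop (𝓝 0) := by
  apply Real.tendsto_exp_atBot.comp
  exact (tendsto_natCast_atTop_atTop (R := ℝ)).const_mul_atTop_of_neg (by linarith)

/-- Slowness of `v` combined with `h` would give `1 ≤ |K| |L| e^{-ηn}` for all `n`. -/
theorem notMem_slowSubmodule_of_dominated (hΦ : IsLinearFlow Φ) (hη : 0 < η) {v : V} (hv : v ≠ 0)
    {L : ℝ} (h : ∀ n : ℕ, ‖Φ n u‖ ≤ L * ‖Φ n v‖) : v ∉ slowSubmodule Φ η u := by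
  rintro ⟨K, hK⟩
  have h0 : Tendsto (fun n : ℕ => |K| * |L| * Real.exp (-η * n)) atTop (𝓝 0) := by
    simpa using (tendsto_exp_neg_mul_nat hη).const_mul (|K| * |L|)
  obtain ⟨n, hn⟩ := (h0.eventually_lt_const one_pos).exists
  have hpos : 0 < ‖Φ n v‖ := norm_pos_iff.2 (hΦ.apply_ne_zero n hv)
  have h1 : ‖Φ n v‖ ≤ |K| * Real.exp (-η * n) * (|L| * ‖Φ n v‖) := by
    refine (hK n).trans ?_
    gcongr
    · exact le_abs_self K
    · exact (h n).trans (mul_le_mul_of_nonneg_right (le_abs_self L) hpos.le)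
  nlinarith

theorem self_notMem_slowSubmodule (hΦ : IsLinearFlow Φ) (hη : 0 < η) (hu : u ≠ 0) :
    u ∉ slowSubmodule Φ η u :=
  hΦ.notMem_slowSubmodule_of_dominated hη hu (L := 1) fun n => by simp

/-- The coefficients supplied by `IsAttractingLine` depend on time. Consecutive ones differ by a
geometric term, so they converge, and their limit serves for all `n` at once. -/
theorem exists_sub_smul_bound (hΦ : IsLinearFlow Φ) (hη : 0 < η) (hu : u ≠ 0) (hK : 0 ≤ K)
    (h : IsAttractingLine Φ K η u) :
    ∃ L : ℝ, 0 ≤ L ∧ ∀ v, ∃ c : ℝ, ∀ n : ℕ,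
      ‖Φ n (v - c • u)‖ ≤ L * Real.exp (-η * n) * ‖Φ n u‖ * ‖v‖ := by
  obtain ⟨κ, hκ, hb⟩ := hΦ.exists_bound
  have hq1 : Real.exp (-η) < 1 := by simpa using hη
  -- `A` bounds the jump from `c n` to `c (n + 1)`: the error at time `n` is pushed by `Φ 1` (a
  -- factor `κ`) and measured against `Φ (n + 1) u` (another `κ`), then the error at time `n + 1` is
  -- added.
  set A : ℝ := κ * K * κ + K with hA
  have hA0 : 0 ≤ A := by positivity
  refine ⟨K + A / (1 - Real.exp (-η)), by have := sub_pos.2 hq1; positivity, fun v => ?_⟩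
  choose c hc using fun n : ℕ => h n n.cast_nonneg v
  have hexp : ∀ n : ℕ, Real.exp (-η * n) = Real.exp (-η) ^ n := fun n => by
    rw [← Real.exp_nat_mul, mul_comm]
  have hstep : ∀ n, dist (c n) (c (n + 1)) ≤ A * ‖v‖ * Real.exp (-η) ^ n := by
    intro n
    have hpos : 0 < ‖Φ (n + 1 : ℕ) u‖ := norm_pos_iff.2 (hΦ.apply_ne_zero _ hu)
    have hnn : ∀ w, Φ (n + 1 : ℕ) w = Φ 1 (Φ n w) := fun w => by
      rw [← hΦ.add]; push_cast; rw [add_comm]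
    have hprev : ‖Φ n u‖ ≤ κ * ‖Φ (n + 1 : ℕ) u‖ := by
      have := hb (-1) (by simp) (Φ (n + 1 : ℕ) u)
      rwa [hnn, hΦ.neg_apply, ← hnn] at this
    have e1 : ‖Φ 1 (Φ n v - c n • Φ n u)‖ ≤
        κ * K * κ * Real.exp (-η) ^ n * ‖v‖ * ‖Φ (n + 1 : ℕ) u‖ := by
      refine (hb 1 (by simp) _).trans ?_
      have := hc n
      rw [hexp] at this
      calc κ * ‖Φ n v - c n • Φ n u‖
          ≤ κ * (K * Real.exp (-η) ^ n * (κ * ‖Φ (n + 1 : ℕ) u‖) * ‖v‖) := by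
            gcongr
            refine this.trans ?_
            gcongr
        _ = _ := by ring
    have e2 : ‖Φ (n + 1 : ℕ) v - c (n + 1) • Φ (n + 1 : ℕ) u‖ ≤
        K * Real.exp (-η) ^ n * ‖v‖ * ‖Φ (n + 1 : ℕ) u‖ := by
      have := hc (n + 1)
      rw [hexp] at this
      have h2 : Real.exp (-η) ^ (n + 1) ≤ Real.exp (-η) ^ n :=
        pow_le_pow_of_le_one (Real.exp_pos _).le hq1.le (Nat.le_succ n)
      calc _ ≤ K * Real.exp (-η) ^ (n + 1) * ‖Φ (n + 1 : ℕ) u‖ * ‖v‖ := this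
        _ ≤ K * Real.exp (-η) ^ n * ‖Φ (n + 1 : ℕ) u‖ * ‖v‖ := by gcongr
        _ = _ := by ring
    have e3 : (c n - c (n + 1)) • Φ (n + 1 : ℕ) u =
        (Φ (n + 1 : ℕ) v - c (n + 1) • Φ (n + 1 : ℕ) u) - Φ 1 (Φ n v - c n • Φ n u) := by
      rw [map_sub, map_smul, ← hnn, ← hnn, sub_smul]
      abel
    have e4 : dist (c n) (c (n + 1)) * ‖Φ (n + 1 : ℕ) u‖ ≤
        A * ‖v‖ * Real.exp (-η) ^ n * ‖Φ (n + 1 : ℕ) u‖ := by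
      rw [dist_eq_norm, ← norm_smul, e3]
      refine (norm_sub_le _ _).trans ((add_le_add e2 e1).trans (le_of_eq ?_))
      rw [hA]; ring
    exact le_of_mul_le_mul_right e4 hpos
  obtain ⟨a, ha⟩ := cauchySeq_tendsto_of_complete (cauchySeq_of_le_geometric _ _ hq1 hstep)
  refine ⟨a, fun n => ?_⟩
  have hd := dist_le_of_le_geometric_of_tendsto _ _ hq1 hstep ha n
  have e5 : Φ n (v - a • u) = (Φ n v - c n • Φ n u) + (c n - a) • Φ n u := by
    rw [map_sub, map_smul, sub_smul]; abel
  rw [e5]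
  refine (norm_add_le _ _).trans ?_
  rw [norm_smul, Real.norm_eq_abs, ← Real.dist_eq]
  calc _ ≤ K * Real.exp (-η * n) * ‖Φ n u‖ * ‖v‖ +
        A * ‖v‖ * Real.exp (-η) ^ n / (1 - Real.exp (-η)) * ‖Φ n u‖ := by
        gcongr
        exact hc n
    _ = _ := by rw [hexp]; ring

theorem exists_sub_smul_mem (hΦ : IsLinearFlow Φ) (hη : 0 < η) (hu : u ≠ 0) (hK : 0 ≤ K)
    (h : IsAttractingLine Φ K η u) (v : V) : ∃ c : ℝ, v - c • u ∈ slowSubmodule Φ η u := by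
  obtain ⟨L, -, hL⟩ := hΦ.exists_sub_smul_bound hη hu hK h
  obtain ⟨c, hc⟩ := hL v
  refine ⟨c, L * ‖v‖, fun n => (hc n).trans (le_of_eq (by ring))⟩

/-- The constant in `slowSubmodule` depends on the vector. Here it becomes uniform, because the
limiting coefficient of a slow vector must vanish: `u` itself is not slow. -/
theorem exists_slow_bound (hΦ : IsLinearFlow Φ) (hη : 0 < η) (hu : u ≠ 0) (hK : 0 ≤ K)
    (h : IsAttractingLine Φ K η u) :
    ∃ L : ℝ, 0 ≤ L ∧ ∀ v ∈ slowSubmodule Φ η u, ∀ n : ℕ,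
      ‖Φ n v‖ ≤ L * Real.exp (-η * n) * ‖Φ n u‖ * ‖v‖ := by
  obtain ⟨L, hL0, hL⟩ := hΦ.exists_sub_smul_bound hη hu hK h
  refine ⟨L, hL0, fun v hv n => ?_⟩
  obtain ⟨c, hc⟩ := hL v
  have hm : v - c • u ∈ slowSubmodule Φ η u :=
    ⟨L * ‖v‖, fun n => (hc n).trans (le_of_eq (by ring))⟩
  have hcu : c • u ∈ slowSubmodule Φ η u := by simpa using sub_mem hv hm
  have hc0 : c = 0 := by
    by_contra hc0
    exact hΦ.self_notMem_slowSubmodule hη hu (((slowSubmodule Φ η u).smul_mem_iff hc0).1 hcu)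
  simpa [hc0] using hc n

/-- Two attracting lines have orbits of comparable size. -/
theorem notMem_slowSubmodule_of_isAttractingLine (hΦ : IsLinearFlow Φ) (hη : 0 < η) {u' : V}
    (hu' : u' ≠ 0) (hK : 0 ≤ K)
    (h' : IsAttractingLine Φ K η u') : u' ∉ slowSubmodule Φ η u := by
  -- The roles are exchanged: `u` is decomposed relatively to `u'`.
  obtain ⟨c, L, hL⟩ := hΦ.exists_sub_smul_mem hη hu' hK h' u
  refine hΦ.notMem_slowSubmodule_of_dominated hη hu' (L := |L| + |c|) fun n => ?_
  have e : Φ n u = Φ n (u - c • u') + c • Φ n u' := by simp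
  rw [e]
  refine (norm_add_le _ _).trans ?_
  rw [norm_smul, Real.norm_eq_abs, add_mul]
  gcongr
  refine (hL n).trans ?_
  have h1 : Real.exp (-η * n) ≤ 1 := by
    rw [Real.exp_le_one_iff]; nlinarith [(n.cast_nonneg : (0 : ℝ) ≤ n)]
  calc _ ≤ |L| * 1 * ‖Φ n u'‖ := by
        gcongr
        exact le_abs_self L
    _ = _ := by ring

/-- The corrections `1 + a q^n ≤ exp (a q^n)` have a bounded product, by summing the geometric
series. -/
theorem le_mul_pow_of_le_add_geometric {g : ℕ → ℝ} {m a q : ℝ} (hm : 0 < m) (ha : 0 ≤ a)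
    (hq0 : 0 ≤ q) (hq1 : q < 1) (hg0 : 0 ≤ g 0)
    (hg : ∀ n, g (n + 1) ≤ g n * (m * (1 + a * q ^ n))) (n : ℕ) :
    g n ≤ g 0 * Real.exp (a / (1 - q)) * m ^ n := by
  have key : ∀ n : ℕ, g n ≤ g 0 * Real.exp (a * ∑ i ∈ Finset.range n, q ^ i) * m ^ n := by
    intro n
    induction n with
    | zero => simp
    | succ n ih =>
      rw [Finset.sum_range_succ, mul_add, Real.exp_add]
      have h1 : 1 + a * q ^ n ≤ Real.exp (a * q ^ n) := by
        linarith [Real.add_one_le_exp (a * q ^ n)]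
      have h2 : 0 ≤ 1 + a * q ^ n := by positivity
      calc g (n + 1) ≤ g n * (m * (1 + a * q ^ n)) := hg n
        _ ≤ (g 0 * Real.exp (a * ∑ i ∈ Finset.range n, q ^ i) * m ^ n) *
            (m * Real.exp (a * q ^ n)) := by gcongr
        _ = _ := by ring
  refine (key n).trans ?_
  gcongr
  rw [div_eq_mul_inv, ← tsum_geometric_of_lt_one hq0 hq1]
  gcongr
  exact (summable_geometric_of_lt_one hq0 hq1).sum_le_tsum _ fun i _ => by positivity

variable [FiniteDimensional ℝ V]

/-- A nonzero attracting line yields a dominated splitting for a linear flow. -/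
theorem exists_dominated_complement (hΦ : IsLinearFlow Φ) (hη : 0 < η) (hu : u ≠ 0) (hK : 0 ≤ K)
    (h : IsAttractingLine Φ K η u) :
    ∃ F : Submodule ℝ V, IsCompl (slowSubmodule Φ η u) F ∧ Module.finrank ℝ F = 1 ∧
      (∀ t, F.map (Φ t).toLinearMap = F) ∧
      ∃ L > (0 : ℝ), ∀ t : ℝ, 0 ≤ t → ∀ v ∈ slowSubmodule Φ η u, ∀ w ∈ F,
        ‖Φ t v‖ * ‖w‖ ≤ L * Real.exp (-η * t) * (‖v‖ * ‖Φ t w‖) := by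
  set S := slowSubmodule Φ η u with hS
  have huS : u ∉ S := hΦ.self_notMem_slowSubmodule hη hu
  obtain ⟨κ, hκ, hb⟩ := hΦ.exists_bound
  obtain ⟨L, hL0, hL⟩ := hΦ.exists_slow_bound hη hu hK h
  have hdec : ∀ v, ∃ c : ℝ, v - c • u ∈ S := hΦ.exists_sub_smul_mem hη hu hK h
  have hq1 : Real.exp (-η) < 1 := by simpa using hη
  have hexp : ∀ n : ℕ, Real.exp (-η * n) = Real.exp (-η) ^ n := fun n => by
    rw [← Real.exp_nat_mul, mul_comm]
  -- `m` is the factor by which `Φ 1` acts on the one-dimensional quotient by `S`.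
  obtain ⟨m, hm⟩ := hdec (Φ 1 u)
  set e₁ := Φ 1 u - m • u with he₁
  have hm0 : m ≠ 0 := by
    rintro rfl
    apply huS
    have := hΦ.map_mem_slowSubmodule (-1) hm
    simpa [he₁, hΦ.neg_apply] using this
  have hnn : ∀ (n : ℕ) w, Φ (n + 1 : ℕ) w = Φ n (Φ 1 w) := fun n w => by
    rw [← hΦ.add]; push_cast; rfl
  have hmp : 0 < |m| := abs_pos.2 hm0
  -- In `Φ (n + 1) u = m Φ n u + Φ n e₁` the last term is a geometrically small fraction of `‖Φ n
  -- u‖`, since `e₁` is slow.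
  obtain ⟨G, hG0, hG⟩ : ∃ G : ℝ, 0 ≤ G ∧ ∀ n : ℕ, ‖Φ n u‖ ≤ G * |m| ^ n := by
    refine ⟨‖Φ (0 : ℕ) u‖ * Real.exp ((L * ‖e₁‖ / |m|) / (1 - Real.exp (-η))), by positivity, ?_⟩
    refine le_mul_pow_of_le_add_geometric (g := fun n : ℕ => ‖Φ n u‖) hmp (by positivity)
      (Real.exp_pos _).le hq1 (norm_nonneg _) (fun n => ?_)
    have e : Φ (n + 1 : ℕ) u = m • Φ n u + Φ n e₁ := by
      rw [hnn, he₁, map_sub, map_smul]; abel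
    rw [e]
    refine (norm_add_le _ _).trans ?_
    rw [norm_smul, Real.norm_eq_abs]
    have := hL e₁ hm n
    rw [hexp] at this
    calc _ ≤ |m| * ‖Φ n u‖ + L * Real.exp (-η) ^ n * ‖Φ n u‖ * ‖e₁‖ := by gcongr
      _ = _ := by field_simp
  have hslow : ∀ v ∈ S, ∀ n : ℕ, ‖Φ n v‖ ≤ L * G * Real.exp (-η * n) * |m| ^ n * ‖v‖ := by
    intro v hv n
    calc _ ≤ L * Real.exp (-η * n) * ‖Φ n u‖ * ‖v‖ := hL v hv n
      _ ≤ L * Real.exp (-η * n) * (G * |m| ^ n) * ‖v‖ := by gcongr; exact hG n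
      _ = _ := by ring
  set B : V →ₗ[ℝ] V := (Φ 1).toLinearMap - m • LinearMap.id with hB
  have hBapp : ∀ v, B v = Φ 1 v - m • v := fun v => by simp [hB]
  have hBS : ∀ v, B v ∈ S := by
    intro v
    obtain ⟨c, hc⟩ := hdec v
    have e : B v = (Φ 1 (v - c • u) - m • (v - c • u)) + c • e₁ := by
      rw [hBapp, he₁, map_sub, map_smul]; module
    rw [e]
    exact add_mem (sub_mem (hΦ.map_mem_slowSubmodule 1 hc) (S.smul_mem _ hc)) (S.smul_mem _ hm)
  -- In finite dimension injectivity would force surjectivity, while the range of `B` misses `u`.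
  have hBinj : ¬ Function.Injective B := by
    intro hi
    obtain ⟨v, hv⟩ := LinearMap.injective_iff_surjective.1 hi u
    exact huS (hv ▸ hBS v)
  obtain ⟨w, hw, hw0⟩ : ∃ w, B w = 0 ∧ w ≠ 0 := by
    rw [← LinearMap.ker_eq_bot, Submodule.eq_bot_iff] at hBinj
    push Not at hBinj
    exact hBinj
  have heig : ∀ w, B w = 0 → ∀ n : ℕ, Φ n w = m ^ n • w := by
    intro w hw n
    have h1 : Φ 1 w = m • w := by rw [hBapp] at hw; exact sub_eq_zero.1 hw
    induction n with
    | zero => simp [hΦ.zero]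
    | succ n ih => rw [hnn, h1, map_smul, ih, smul_smul, pow_succ, mul_comm]
  -- A kernel vector of `B` grows exactly like `|m|^n`, which is too fast for a nonzero slow vector.
  have hker : ∀ w ∈ S, B w = 0 → w = 0 := by
    intro w hwS hw
    by_contra hw0
    have h0 : Tendsto (fun n : ℕ => L * G * Real.exp (-η * n)) atTop (𝓝 0) := by
      simpa using (tendsto_exp_neg_mul_nat hη).const_mul (L * G)
    obtain ⟨n, hn⟩ := (h0.eventually_lt_const one_pos).exists
    have h1 := hslow w hwS n
    rw [heig w hw, norm_smul, norm_pow, Real.norm_eq_abs] at h1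
    have h2 : 0 < |m| ^ n * ‖w‖ := mul_pos (pow_pos hmp n) (norm_pos_iff.2 hw0)
    nlinarith
  have hwS : w ∉ S := fun hwS => hw0 (hker w hwS hw)
  have hdecw : ∀ v, ∃ c : ℝ, v - c • w ∈ S := by
    intro v
    obtain ⟨a, ha⟩ := hdec w
    obtain ⟨b, hb⟩ := hdec v
    have ha0 : a ≠ 0 := by
      rintro rfl
      exact hwS (by simpa using ha)
    refine ⟨b / a, ?_⟩
    have e : v - (b / a) • w = (v - b • u) - (b / a) • (w - a • u) := by
      rw [smul_sub, smul_smul, div_mul_cancel₀ _ ha0]; abel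
    rw [e]
    exact sub_mem hb (S.smul_mem _ ha)
  -- `w` is built from `Φ 1` only. For real `t`, `Φ t w - a w` lies in `S` for a suitable `a`, and
  -- in the kernel of `B` because `B` commutes with `Φ t`; hence it vanishes.
  have hinv : ∀ t, ∃ a : ℝ, Φ t w = a • w := by
    intro t
    obtain ⟨a, ha⟩ := hdecw (Φ t w)
    refine ⟨a, sub_eq_zero.1 (hker _ ha ?_)⟩
    have h1 : B (Φ t w) = Φ t (B w) := by rw [hBapp, hBapp, map_sub, map_smul, hΦ.comm]
    rw [map_sub, map_smul, h1, hw]; simp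
  have hmap : ∀ t, (ℝ ∙ w).map (Φ t).toLinearMap ≤ ℝ ∙ w := by
    intro t
    obtain ⟨a, ha⟩ := hinv t
    rw [Submodule.map_span_le]
    rintro _ rfl
    exact Submodule.mem_span_singleton.2 ⟨a, ha.symm⟩
  refine ⟨ℝ ∙ w, ⟨?_, ?_⟩, finrank_span_singleton hw0, fun t => le_antisymm (hmap t) ?_, ?_⟩
  · rw [Submodule.disjoint_def]
    intro v hv hvw
    obtain ⟨a, rfl⟩ := Submodule.mem_span_singleton.1 hvw
    by_contra ha
    have ha0 : a ≠ 0 := fun h => ha (by simp [h])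
    exact hwS ((S.smul_mem_iff ha0).1 hv)
  · rw [codisjoint_iff, Submodule.eq_top_iff']
    intro v
    obtain ⟨c, hc⟩ := hdecw v
    exact Submodule.mem_sup.2 ⟨_, hc, c • w, Submodule.mem_span_singleton.2 ⟨c, rfl⟩, by simp⟩
  · intro v hv
    exact ⟨Φ (-t) v, hmap (-t) ⟨v, hv, rfl⟩, hΦ.apply_neg t v⟩
  -- Passing from `t` to its integer part costs `κ` for each vector and `exp η` for the rate; the `+
  -- 1` keeps the constant positive.
  · refine ⟨κ * κ * (L * G + 1) * Real.exp η, by positivity, fun t ht v hv w' hw' => ?_⟩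
    obtain ⟨a, rfl⟩ := Submodule.mem_span_singleton.1 hw'
    set n := ⌊t⌋₊ with hn
    have h1 : (n : ℝ) ≤ t := Nat.floor_le ht
    have h2 : t < n + 1 := Nat.lt_floor_add_one t
    have h3 : |t - n| ≤ 1 := by rw [abs_le]; constructor <;> linarith
    have h3' : |(n : ℝ) - t| ≤ 1 := by rwa [abs_sub_comm]
    have h4 : ‖Φ t v‖ ≤ κ * ‖Φ n v‖ := by
      have := hb _ h3 (Φ n v)
      rwa [← hΦ.add, sub_add_cancel] at this
    have h5 : |m| ^ n * ‖a • w‖ ≤ κ * ‖Φ t (a • w)‖ := by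
      have := hb _ h3' (Φ t (a • w))
      rwa [← hΦ.add, sub_add_cancel, heig _ (by rw [map_smul, hw, smul_zero]), norm_smul (m ^ n),
        norm_pow, Real.norm_eq_abs] at this
    have h6 : Real.exp (-η * n) ≤ Real.exp η * Real.exp (-η * t) := by
      rw [← Real.exp_add]
      apply Real.exp_le_exp.2
      nlinarith
    calc ‖Φ t v‖ * ‖a • w‖ ≤ κ * (L * G * Real.exp (-η * n) * |m| ^ n * ‖v‖) * ‖a • w‖ := by
          gcongr
          exact h4.trans (by gcongr; exact hslow v hv n)
      _ = κ * (L * G) * Real.exp (-η * n) * ‖v‖ * (|m| ^ n * ‖a • w‖) := by ring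
      _ ≤ κ * (L * G + 1) * (Real.exp η * Real.exp (-η * t)) * ‖v‖ * (κ * ‖Φ t (a • w)‖) := by
          gcongr
          linarith
      _ = _ := by ring

end IsLinearFlow

end LinearFlow

/-! ### Flows of compactly supported `C^1` fields on a normed space -/

section GlobalFlow

open scoped NNReal

variable {E : Type*} [NormedAddCommGroup E] [NormedSpace ℝ E] {f : E → E} {φ : ℝ → E → E}

/-- `φ` is the flow of the complete vector field `f` of the normed space `E`. -/
structure IsGlobalFlow (f : E → E) (φ : ℝ → E → E) : Prop where
  zero : ∀ z, φ 0 z = z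
  hasDerivAt : ∀ z t, HasDerivAt (fun s => φ s z) (f (φ t z)) t

theorem isMIntegralCurveOn_of_hasDerivAt {γ : ℝ → E} {s : Set ℝ}
    (h : ∀ t ∈ s, HasDerivAt γ (f (γ t)) t) :
    IsMIntegralCurveOn (I := 𝓘(ℝ, E)) γ (fun z => (f z : TangentSpace 𝓘(ℝ, E) z)) s := by
  intro t ht
  exact (hasMFDerivAt_iff_hasFDerivAt.2 (h t ht).hasFDerivAt).hasMFDerivWithinAt

theorem hasDerivAt_of_isMIntegralCurve {γ : ℝ → E}
    (h : IsMIntegralCurve (I := 𝓘(ℝ, E)) γ (fun z => (f z : TangentSpace 𝓘(ℝ, E) z))) (t : ℝ) :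
    HasDerivAt γ (f (γ t)) t := by
  have h' : HasFDerivAt γ ((1 : ℝ →L[ℝ] ℝ).smulRight (f (γ t))) t :=
    hasMFDerivAt_iff_hasFDerivAt.1 (h t)
  simpa using h'.hasDerivAt

/-- A compactly supported `C^1` vector field of a finite-dimensional space is complete. -/
theorem exists_isGlobalFlow [FiniteDimensional ℝ E] (hf : ContDiff ℝ 1 f)
    (hs : HasCompactSupport f) : ∃ φ : ℝ → E → E, IsGlobalFlow f φ := by
  have : CompleteSpace E := FiniteDimensional.complete ℝ E
  obtain ⟨K, hK⟩ := hf.lipschitzWith_of_hasCompactSupport hs one_ne_zero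
  obtain ⟨B, hB⟩ := hs.exists_bound_of_continuous hf.continuous
  set L : ℝ≥0 := ⟨|B|, abs_nonneg B⟩ with hL
  -- The field is globally bounded and Lipschitz, so this existence time works for every initial
  -- point, which yields completeness.
  set ε : ℝ := 1 / (|B| + 1) with hε
  have hεpos : 0 < ε := by positivity
  have hloc : ∀ z : E, ∃ γ : ℝ → E, γ 0 = z ∧ IsMIntegralCurveOn (I := 𝓘(ℝ, E)) γ
      (fun z => (f z : TangentSpace 𝓘(ℝ, E) z)) (Set.Ioo (-ε) ε) := by
    intro z
    have hpl : IsPicardLindelof (fun _ => f) (tmin := -ε) (tmax := ε)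
        ⟨0, by simp [hεpos.le]⟩ z 1 0 L K := by
      apply IsPicardLindelof.of_time_independent
      · intro x _
        exact (hB x).trans (le_abs_self B)
      · exact hK.lipschitzOnWith
      · simp only [sub_zero, zero_sub, neg_neg, max_self, NNReal.coe_one, NNReal.coe_zero, hL, hε]
        rw [mul_one_div, div_le_one (by positivity)]
        exact (lt_add_one |B|).le
    obtain ⟨α, h0, hα⟩ := hpl.exists_eq_forall_mem_Icc_hasDerivWithinAt₀
    refine ⟨α, h0, isMIntegralCurveOn_of_hasDerivAt fun t ht => ?_⟩
    exact (hα t (Set.Ioo_subset_Icc_self ht)).hasDerivAt (Icc_mem_nhds ht.1 ht.2)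
  have hsec : ContMDiff 𝓘(ℝ, E) 𝓘(ℝ, E).tangent 1
      (fun x => (⟨x, f x⟩ : TangentBundle 𝓘(ℝ, E) E)) := by
    exact (contMDiff_vectorSpace_iff_contDiff (V := fun x => (f x : TangentSpace 𝓘(ℝ, E) x))).2 hf
  choose γ h0 hγ using fun z => exists_isMIntegralCurve_of_isMIntegralCurveOn hsec hεpos hloc z
  exact ⟨fun t z => γ z t, h0, fun z t => hasDerivAt_of_isMIntegralCurve (hγ z) t⟩

/-- Strict differentiability at `z` makes `g - g' z` Lipschitz with small constant near `z`; that
constant bounds `‖g' w - g' z‖` for nearby `w`. -/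
theorem contDiff_one_of_hasStrictFDerivAt {F : Type*} [NormedAddCommGroup F]
    [NormedSpace ℝ F] {g : E → F} {g' : E → E →L[ℝ] F} (h : ∀ z, HasStrictFDerivAt g (g' z) z) :
    ContDiff ℝ 1 g := by
  rw [contDiff_one_iff_hasFDerivAt]
  refine ⟨g', ?_, fun z => (h z).hasFDerivAt⟩
  rw [continuous_iff_continuousAt]
  intro z
  rw [Metric.continuousAt_iff']
  intro ε hε
  obtain ⟨s, hs, hl⟩ := (h z).approximates_deriv_on_nhds (c := ⟨ε / 2, (half_pos hε).le⟩)
    (Or.inr (NNReal.coe_pos.1 (half_pos hε)))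
  filter_upwards [eventually_mem_nhds_iff.2 hs] with w hw
  rw [dist_eq_norm]
  have h1 : HasFDerivAt (fun x => g x - g' z x) (g' w - g' z) w :=
    (h w).hasFDerivAt.sub (g' z).hasFDerivAt
  refine (h1.le_of_lipschitzOn hw hl.lipschitzOnWith).trans_lt ?_
  exact half_lt_self hε

namespace IsGlobalFlow

theorem neg (hφ : IsGlobalFlow f φ) : IsGlobalFlow (fun z => -f z) (fun t => φ (-t)) := by
  refine ⟨fun z => by simp [hφ.zero], fun z t => ?_⟩
  have := (hφ.hasDerivAt z (-t)).scomp t (hasDerivAt_neg t)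
  simpa [Function.comp_def] using this

theorem continuous_time (hφ : IsGlobalFlow f φ) (z : E) : Continuous fun t => φ t z :=
  continuous_iff_continuousAt.2 fun t => (hφ.hasDerivAt z t).continuousAt

theorem add (hφ : IsGlobalFlow f φ) {K : ℝ≥0} (hK : LipschitzWith K f) (s t : ℝ) (z : E) :
    φ (s + t) z = φ s (φ t z) := by
  have h := ODE_solution_unique_univ (v := fun _ => f) (s := fun _ => Set.univ) (K := K)
    (f := fun s => φ (s + t) z) (g := fun s => φ s (φ t z)) (t₀ := 0)
    (fun _ => hK.lipschitzOnWith)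
    (fun s => ⟨(hφ.hasDerivAt z (s + t)).comp_add_const s t, trivial⟩)
    (fun s => ⟨hφ.hasDerivAt (φ t z) s, trivial⟩) (by simp [hφ.zero])
  exact congrFun h s

theorem apply_eq_of_zero (hφ : IsGlobalFlow f φ) {K : ℝ≥0} (hK : LipschitzWith K f) {p : E}
    (hp : f p = 0) (t : ℝ) : φ t p = p := by
  have h := ODE_solution_unique_univ (v := fun _ => f) (s := fun _ => Set.univ) (K := K)
    (f := fun s => φ s p) (g := fun _ => p) (t₀ := 0)
    (fun _ => hK.lipschitzOnWith) (fun s => ⟨hφ.hasDerivAt p s, trivial⟩)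
    (fun s => ⟨by simpa [hp] using hasDerivAt_const s p, trivial⟩) (hφ.zero p)
  exact congrFun h t

theorem dist_le_of_nonneg (hφ : IsGlobalFlow f φ) {K : ℝ≥0} (hK : LipschitzWith K f) {t : ℝ}
    (ht : 0 ≤ t) (z w : E) : dist (φ t z) (φ t w) ≤ Real.exp (K * t) * dist z w := by
  have := dist_le_of_trajectories_ODE (v := fun _ => f) (K := K) (f := fun s => φ s z)
    (g := fun s => φ s w) (a := 0) (b := t) (δ := dist z w) (fun _ => hK)
    (hφ.continuous_time z).continuousOn (fun s _ => (hφ.hasDerivAt z s).hasDerivWithinAt)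
    (hφ.continuous_time w).continuousOn (fun s _ => (hφ.hasDerivAt w s).hasDerivWithinAt)
    (by simp [hφ.zero]) t ⟨ht, le_rfl⟩
  rwa [sub_zero, mul_comm] at this

theorem dist_le (hφ : IsGlobalFlow f φ) {K : ℝ≥0} (hK : LipschitzWith K f) (t : ℝ) (z w : E) :
    dist (φ t z) (φ t w) ≤ Real.exp (K * |t|) * dist z w := by
  rcases le_total 0 t with ht | ht
  · rw [abs_of_nonneg ht]
    exact hφ.dist_le_of_nonneg hK ht z w
  · rw [abs_of_nonpos ht]
    have := hφ.neg.dist_le_of_nonneg (K := K) hK.neg (t := -t) (by linarith) z w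
    simpa using this

theorem norm_fderiv_le (hφ : IsGlobalFlow f φ) {K : ℝ≥0} (hK : LipschitzWith K f) (t : ℝ) (z : E) :
    ‖fderiv ℝ (φ t) z‖ ≤ Real.exp (K * |t|) := by
  have h : LipschitzWith ⟨Real.exp (K * |t|), (Real.exp_pos _).le⟩ (φ t) :=
    LipschitzWith.of_dist_le_mul fun z w => hφ.dist_le hK t z w
  exact norm_fderiv_le_of_lipschitz ℝ h

/-- Existence, for a short time, of the fundamental solution of a linear equation. -/
theorem exists_fundamental_solution [CompleteSpace E] {A : ℝ → E →L[ℝ] E} {κ : ℝ≥0} {ε : ℝ}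
    (hε : 0 ≤ ε) (hA : ContinuousOn A (Set.Icc 0 ε)) (hκ : ∀ t ∈ Set.Icc 0 ε, ‖A t‖ ≤ κ)
    (hκε : 2 * κ * ε ≤ 1) :
    ∃ Y : ℝ → E →L[ℝ] E, Y 0 = ContinuousLinearMap.id ℝ E ∧ ∀ t ∈ Set.Icc 0 ε,
      HasDerivWithinAt Y (A t ∘L Y t) (Set.Icc 0 ε) t := by
  have hpl : IsPicardLindelof (fun t (Y : E →L[ℝ] E) => A t ∘L Y) (tmin := 0) (tmax := ε)
      -- In the unit ball around the identity `‖Y‖ ≤ 2`, so the field is bounded by `2 * κ` and the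
      -- solution stays in the ball as long as `2 * κ * ε ≤ 1`.
      ⟨0, by simp [hε]⟩ (ContinuousLinearMap.id ℝ E) 1 0 (2 * κ) κ := by
    refine ⟨fun t ht => LipschitzOnWith.of_dist_le_mul fun Y _ Z _ => ?_, fun Y _ => ?_,
      fun t ht Y hY => ?_, ?_⟩
    · rw [dist_eq_norm, dist_eq_norm, ← ContinuousLinearMap.comp_sub]
      exact (ContinuousLinearMap.opNorm_comp_le _ _).trans (by gcongr; exact hκ t ht)
    · exact hA.clm_comp continuousOn_const
    · have h1 : ‖Y‖ ≤ 2 := by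
        have := norm_le_norm_sub_add Y (ContinuousLinearMap.id ℝ E)
        have h2 : ‖Y - ContinuousLinearMap.id ℝ E‖ ≤ 1 := by
          simpa [dist_eq_norm] using hY
        have h3 : ‖ContinuousLinearMap.id ℝ E‖ ≤ 1 := ContinuousLinearMap.norm_id_le
        linarith
      refine (ContinuousLinearMap.opNorm_comp_le _ _).trans ?_
      calc ‖A t‖ * ‖Y‖ ≤ κ * 2 := by gcongr; exact hκ t ht
        _ = _ := by push_cast; ring
    · simpa [hε] using hκε
  exact hpl.exists_eq_forall_mem_Icc_hasDerivWithinAt₀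

/-- The derivative is the solution `Y` of the variational equation along the orbit of `z`. Comparing
two arbitrary nearby points `w`, `w'`, Grönwall's inequality bounds `φ s w - φ s w' - Y s (w - w')`,
which gives strictness directly. -/
theorem hasStrictFDerivAt_of_nonneg [CompleteSpace E] (hφ : IsGlobalFlow f φ) {K : ℝ≥0}
    (hK : LipschitzWith K f) (hf : ContDiff ℝ 1 f) (hu : UniformContinuous (fderiv ℝ f)) {t : ℝ}
    (ht : 0 ≤ t) (hKt : 2 * K * t ≤ 1) (z : E) :
    ∃ D : E →L[ℝ] E, HasStrictFDerivAt (φ t) D z := by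
  have hA : Continuous fun s => fderiv ℝ f (φ s z) :=
    (hf.continuous_fderiv one_ne_zero).comp (hφ.continuous_time z)
  obtain ⟨Y, hY0, hY⟩ := exists_fundamental_solution (A := fun s => fderiv ℝ f (φ s z)) (κ := K) ht
    hA.continuousOn (fun s _ => norm_fderiv_le_of_lipschitz ℝ hK) hKt
  refine ⟨Y t, HasStrictFDerivAt.of_isLittleO ?_⟩
  rw [Asymptotics.isLittleO_iff]
  intro c hc
  set Λ := Real.exp (K * t) with hΛ
  have hΛ0 : 0 < Λ := Real.exp_pos _
  set G := gronwallBound 0 K 1 t with hG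
  have hGε : ∀ ε, gronwallBound 0 K ε t = ε * G := by
    intro ε
    rw [hG]
    rcases eq_or_ne (K : ℝ) 0 with h | h
    · rw [h, gronwallBound_K0, gronwallBound_K0]; ring
    · rw [gronwallBound_of_K_ne_0 h, gronwallBound_of_K_ne_0 h]; ring
  have hG0 : 0 ≤ G := by
    have := gronwallBound_mono (δ := 0) (ε := 1) (K := K) le_rfl zero_le_one K.2 ht
    simpa [gronwallBound_x0] using this
  -- Chosen so that the final Grönwall bound `e * Λ * G` is at most `c`.
  set e := c / (Λ * (G + 1)) with he
  have he0 : 0 < e := by positivity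
  obtain ⟨δ, hδ, hδu⟩ := Metric.uniformContinuous_iff.1 hu e he0
  have hnear : ∀ᶠ w in 𝓝 z, Λ * dist w z < δ := by
    have : Tendsto (fun w => Λ * dist w z) (𝓝 z) (𝓝 (Λ * dist z z)) :=
      (continuous_const.mul (continuous_id.dist continuous_const)).tendsto z
    rw [dist_self, mul_zero] at this
    exact this.eventually_lt_const hδ
  have hΛs : ∀ s ∈ Set.Icc 0 t, Real.exp (K * s) ≤ Λ := fun s hs =>
    Real.exp_le_exp.2 (mul_le_mul_of_nonneg_left hs.2 K.2)
  filter_upwards [hnear.prod_nhds hnear] with ⟨w, w'⟩ ⟨hw, hw'⟩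
  have hin : ∀ v, Λ * dist v z < δ → ∀ s ∈ Set.Icc 0 t, φ s v ∈ Metric.ball (φ s z) δ := by
    intro v hv s hs
    rw [Metric.mem_ball]
    exact ((hφ.dist_le_of_nonneg hK hs.1 v z).trans
      (mul_le_mul_of_nonneg_right (hΛs s hs) dist_nonneg)).trans_lt hv
  set h : ℝ → E := fun s => φ s w - φ s w' - Y s (w - w') with hh
  set h' : ℝ → E := fun s => f (φ s w) - f (φ s w') - fderiv ℝ f (φ s z) (Y s (w - w')) with hh'
  have hder : ∀ s ∈ Set.Icc 0 t, HasDerivWithinAt h (h' s) (Set.Icc 0 t) s := by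
    intro s hs
    exact (((hφ.hasDerivAt w s).sub (hφ.hasDerivAt w' s)).hasDerivWithinAt).sub
      (by simpa using (hY s hs).clm_apply (hasDerivWithinAt_const s _ (w - w')))
  have hbound : ∀ s ∈ Set.Ico 0 t, ‖h' s‖ ≤ K * ‖h s‖ + e * Λ * ‖w - w'‖ := by
    intro s hs
    have hs' := Set.Ico_subset_Icc_self hs
    have h1 : h' s = (f (φ s w) - f (φ s w') - fderiv ℝ f (φ s z) (φ s w - φ s w')) +
        fderiv ℝ f (φ s z) (h s) := by
      simp only [hh, hh', map_sub]; abel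
    have h2 : ‖f (φ s w) - f (φ s w') - fderiv ℝ f (φ s z) (φ s w - φ s w')‖ ≤
        e * ‖φ s w - φ s w'‖ := by
      refine Convex.norm_image_sub_le_of_norm_hasFDerivWithin_le' (s := Metric.ball (φ s z) δ)
        (f' := fderiv ℝ f)
        (fun x _ => ((hf.differentiable one_ne_zero) x).hasFDerivAt.hasFDerivWithinAt)
        (fun x hx => ?_) (convex_ball _ _) (hin w' hw' s hs') (hin w hw s hs')
      rw [← dist_eq_norm]
      exact (hδu (Metric.mem_ball.1 hx)).le
    have h3 : ‖φ s w - φ s w'‖ ≤ Λ * ‖w - w'‖ := by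
      rw [← dist_eq_norm, ← dist_eq_norm]
      exact (hφ.dist_le_of_nonneg hK hs.1 w w').trans
        (mul_le_mul_of_nonneg_right (hΛs s hs') dist_nonneg)
    have h4 : ‖fderiv ℝ f (φ s z) (h s)‖ ≤ K * ‖h s‖ :=
      ContinuousLinearMap.le_of_opNorm_le _ (norm_fderiv_le_of_lipschitz ℝ hK) _
    rw [h1]
    refine (norm_add_le _ _).trans ?_
    have h5 : e * ‖φ s w - φ s w'‖ ≤ e * (Λ * ‖w - w'‖) := by gcongr
    linarith
  have hfin := norm_le_gronwallBound_of_norm_deriv_right_le (f := h) (f' := h') (a := 0) (b := t)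
    (δ := 0) (K := K) (ε := e * Λ * ‖w - w'‖) (fun s hs => (hder s hs).continuousWithinAt)
    (fun s hs => 
      (hder s (Set.Ico_subset_Icc_self hs)).mono_of_mem_nhdsWithin (Icc_mem_nhdsGE_of_mem hs)) (by simp [hh, hφ.zero, hY0])
    hbound t ⟨ht, le_rfl⟩
  rw [sub_zero, hGε] at hfin
  refine hfin.trans ?_
  have h6 : e * Λ * G ≤ c := by
    have : e * (Λ * (G + 1)) = c := div_mul_cancel₀ _ (by positivity)
    nlinarith [mul_pos he0 hΛ0]
  calc e * Λ * ‖w - w'‖ * G = e * Λ * G * ‖w - w'‖ := by ring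
    _ ≤ c * ‖w - w'‖ := by gcongr

/-- The flow of a compactly supported `C^1` vector field is of class `C^1`. -/
theorem contDiff [FiniteDimensional ℝ E] (hφ : IsGlobalFlow f φ) (hf : ContDiff ℝ 1 f)
    (hs : HasCompactSupport f) (t : ℝ) : ContDiff ℝ 1 (φ t) := by
  have : CompleteSpace E := FiniteDimensional.complete ℝ E
  obtain ⟨K, hK⟩ := hf.lipschitzWith_of_hasCompactSupport hs one_ne_zero
  have hu : UniformContinuous (fderiv ℝ f) :=
    (hs.fderiv ℝ).uniformContinuous_of_continuous (hf.continuous_fderiv one_ne_zero)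
  have hsmall : ∀ t : ℝ, 2 * K * |t| ≤ 1 → ContDiff ℝ 1 (φ t) := by
    intro t ht
    rcases le_total 0 t with h0 | h0
    · rw [abs_of_nonneg h0] at ht
      choose D hD using hφ.hasStrictFDerivAt_of_nonneg hK hf hu h0 ht
      exact contDiff_one_of_hasStrictFDerivAt hD
    · rw [abs_of_nonpos h0] at ht
      have hu' : UniformContinuous (fderiv ℝ fun z => -f z) := by
        have h1 : (fderiv ℝ fun z => -f z) = fun z => -fderiv ℝ f z := funext fun z => fderiv_fun_neg
        rw [h1]
        exact hu.neg
      choose D hD using hφ.neg.hasStrictFDerivAt_of_nonneg (K := K) hK.neg hf.neg hu'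
        (by linarith) ht
      simp only [neg_neg] at hD
      exact contDiff_one_of_hasStrictFDerivAt hD
  -- A long time is cut into `n` short ones, and the flow is an iterate.
  obtain ⟨n, hn⟩ := exists_nat_gt (2 * K * |t|)
  have hn0 : (0 : ℝ) < n := lt_of_le_of_lt (by positivity) hn
  have hiter : ∀ (k : ℕ) (z : E), φ (k * (t / n)) z = (φ (t / n))^[k] z := by
    intro k
    induction k with
    | zero => intro z; simp [hφ.zero]
    | succ k ih =>
      intro z
      rw [Function.iterate_succ_apply', ← ih, ← hφ.add hK]
      congr 1
      push_cast
      ring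
  have heq : φ t = (φ (t / n))^[n] := by
    funext z
    rw [← hiter, mul_div_cancel₀ _ hn0.ne']
  have hstep : ContDiff ℝ 1 (φ (t / n)) := by
    apply hsmall
    rw [abs_div, abs_of_pos hn0, mul_div_assoc', div_le_one hn0]
    exact hn.le
  have hpow : ∀ m : ℕ, ContDiff ℝ 1 (φ (t / n))^[m] := by
    intro m
    induction m with
    | zero => exact contDiff_id
    | succ m ih => rw [Function.iterate_succ]; exact ih.comp hstep
  rw [heq]
  exact hpow n

end IsGlobalFlow

end GlobalFlow

/-! ### Cut-off, and the vector field in a chart -/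

/-- A germ of `C^1` map extends to a compactly supported `C^1` map. -/
theorem _root_.ContDiffAt.exists_contDiff_hasCompactSupport {E F : Type*} [NormedAddCommGroup E]
    [NormedSpace ℝ E] [FiniteDimensional ℝ E] [NormedAddCommGroup F] [NormedSpace ℝ F]
    {g : E → F} {p : E} (hg : ContDiffAt ℝ 1 g p) :
    ∃ f : E → F, ContDiff ℝ 1 f ∧ HasCompactSupport f ∧ f =ᶠ[𝓝 p] g := by
  obtain ⟨r, hr, hball⟩ := Metric.eventually_nhds_iff_ball.1 (hg.eventually (by simp))
  let χ : ContDiffBump p := ⟨r / 4, r / 2, by positivity, by linarith⟩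
  refine ⟨fun z => χ z • g z, ?_, χ.hasCompactSupport.smul_right, ?_⟩
  · rw [contDiff_iff_contDiffAt]
    intro z
    by_cases hz : z ∈ Metric.ball p r
    · exact χ.contDiff.contDiffAt.smul (hball z hz)
    · have h0 : (fun z => χ z • g z) =ᶠ[𝓝 z] fun _ => 0 := by
        have : z ∉ tsupport χ := by
          rw [χ.tsupport_eq]
          intro h
          refine hz (Metric.closedBall_subset_ball ?_ h)
          change r / 2 < r
          linarith
        filter_upwards [notMem_tsupport_iff_eventuallyEq.1 this] with w hw
        simp [hw]
      exact contDiffAt_const.congr_of_eventuallyEq h0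
  · filter_upwards [χ.eventuallyEq_one] with z hz
    simp [hz]

section Chart

variable {E : Type*} [NormedAddCommGroup E] [NormedSpace ℝ E]
  {M : Type*} [TopologicalSpace M] [ChartedSpace E M] {X : (x : M) → TangentSpace 𝓘(ℝ, E) x}

/-- The derivative at `y` of the chart at `σ`. -/
def chartDeriv (E : Type*) [NormedAddCommGroup E] [NormedSpace ℝ E] {M : Type*}
    [TopologicalSpace M] [ChartedSpace E M] (σ y : M) : TangentSpace 𝓘(ℝ, E) y →L[ℝ] E :=
  mfderiv 𝓘(ℝ, E) 𝓘(ℝ, E) (extChartAt 𝓘(ℝ, E) σ) y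

/-- The vector field `X` read in the chart at `σ`. -/
def chartField (X : (x : M) → TangentSpace 𝓘(ℝ, E) x) (σ : M) (z : E) : E :=
  chartDeriv E σ ((extChartAt 𝓘(ℝ, E) σ).symm z) (X ((extChartAt 𝓘(ℝ, E) σ).symm z))

variable [IsManifold 𝓘(ℝ, E) 1 M]

theorem chartDeriv_eq_tangentCoordChange {σ y : M} (hy : y ∈ (extChartAt 𝓘(ℝ, E) σ).source) :
    chartDeriv E σ y = tangentCoordChange 𝓘(ℝ, E) y σ y := by
  rw [extChartAt_source] at hy
  exact mfderiv_chartAt_eq_tangentCoordChange hy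

theorem contDiffAt_chartField
    (hX : ContMDiff 𝓘(ℝ, E) 𝓘(ℝ, E).tangent 1
      (fun x => (⟨x, X x⟩ : TangentBundle 𝓘(ℝ, E) M))) (σ : M) :
    ContDiffAt ℝ 1 (chartField X σ) (extChartAt 𝓘(ℝ, E) σ σ) := by
  have hv := contMDiffAt_iff.1 (hX σ)
  refine (hv.2.contDiffAt (range_mem_nhds_isInteriorPoint
      (BoundarylessManifold.isInteriorPoint (I := 𝓘(ℝ, E)) (x := σ)))).snd.congr_of_eventuallyEq ?_
  filter_upwards [extChartAt_target_mem_nhds (I := 𝓘(ℝ, E)) σ] with z hz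
  rw [chartField, chartDeriv_eq_tangentCoordChange ((extChartAt 𝓘(ℝ, E) σ).map_target hz)]
  rfl

/-- The derivative of the inverse chart undoes `chartDeriv`, hence carries `chartField X σ` back to
`X`. -/
theorem isMIntegralCurveOn_symm_comp {σ : M} {γ : ℝ → E} {s : Set ℝ}
    (hγ : ∀ t ∈ s, HasDerivAt γ (chartField X σ (γ t)) t)
    (hs : ∀ t ∈ s, γ t ∈ (extChartAt 𝓘(ℝ, E) σ).target) :
    IsMIntegralCurveOn (I := 𝓘(ℝ, E)) ((extChartAt 𝓘(ℝ, E) σ).symm ∘ γ) X s := by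
  intro t ht
  apply HasMFDerivAt.hasMFDerivWithinAt
  have h1 : HasMFDerivAt 𝓘(ℝ, ℝ) 𝓘(ℝ, E) γ t
      ((1 : ℝ →L[ℝ] ℝ).smulRight (chartField X σ (γ t)) : ℝ →L[ℝ] E) :=
    hasMFDerivAt_iff_hasFDerivAt.2 (hγ t ht).hasFDerivAt
  have h2 : MDifferentiableAt 𝓘(ℝ, E) 𝓘(ℝ, E) (extChartAt 𝓘(ℝ, E) σ).symm (γ t) := by
    rw [← mdifferentiableWithinAt_univ]
    simpa using mdifferentiableWithinAt_extChartAt_symm (I := 𝓘(ℝ, E)) (hs t ht)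
  have h3 := mfderivWithin_extChartAt_symm_comp_mfderiv_extChartAt (I := 𝓘(ℝ, E)) (hs t ht)
  have h4 := h2.hasMFDerivAt.comp t h1
  refine h4.congr_mfderiv ?_
  simp only [modelWithCornersSelf_coe, Set.range_id, mfderivWithin_univ] at h3
  ext
  have h5 := DFunLike.congr_fun h3 (X ((extChartAt 𝓘(ℝ, E) σ).symm (γ t)))
  have h6 : ((1 : ℝ →L[ℝ] ℝ).smulRight (chartField X σ (γ t))) 1 = chartField X σ (γ t) := by simp
  exact (congrArg (mfderiv 𝓘(ℝ, E) 𝓘(ℝ, E) (extChartAt 𝓘(ℝ, E) σ).symm (γ t)) h6).trans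
    (h5.trans (one_smul ℝ _).symm)

end Chart

/-! ### Group property of the flow and invariance of `X` -/

section FlowGroup

variable {E : Type*} [NormedAddCommGroup E] [NormedSpace ℝ E] [CompleteSpace E]
  {M : Type*} [TopologicalSpace M] [T2Space M] [CompactSpace M] [ChartedSpace E M]
  [IsManifold 𝓘(ℝ, E) 1 M] {X : (x : M) → TangentSpace 𝓘(ℝ, E) x}

theorem flow_zero (hX : ContMDiff 𝓘(ℝ, E) 𝓘(ℝ, E).tangent 1
      (fun x => (⟨x, X x⟩ : TangentBundle 𝓘(ℝ, E) M))) (x : M) : flow X 0 x = x :=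
  (flow_spec hX x).1

theorem flow_add (hX : ContMDiff 𝓘(ℝ, E) 𝓘(ℝ, E).tangent 1
      (fun x => (⟨x, X x⟩ : TangentBundle 𝓘(ℝ, E) M))) (s t : ℝ) (x : M) :
    flow X (s + t) x = flow X s (flow X t x) := by
  have h := isMIntegralCurve_Ioo_eq_of_contMDiff_boundaryless (t₀ := 0) hX
    ((flow_spec hX x).2.comp_add t) (flow_spec hX (flow X t x)).2
    (by simp [flow_zero hX])
  exact congrFun h s

theorem flow_eq_self_of_eq_zero (hX : ContMDiff 𝓘(ℝ, E) 𝓘(ℝ, E).tangent 1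
      (fun x => (⟨x, X x⟩ : TangentBundle 𝓘(ℝ, E) M))) {σ : M} (hσ : X σ = 0) (t : ℝ) :
    flow X t σ = σ := by
  have h := isMIntegralCurve_Ioo_eq_of_contMDiff_boundaryless (t₀ := 0) hX
    (flow_spec hX σ).2 (isMIntegralCurve_const hσ) (flow_zero hX σ)
  exact congrFun h t

/-- The tangent flow preserves the vector field. -/
theorem tangentFlow_self (hX : ContMDiff 𝓘(ℝ, E) 𝓘(ℝ, E).tangent 1
      (fun x => (⟨x, X x⟩ : TangentBundle 𝓘(ℝ, E) M))) {t : ℝ} {x : M}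
    (hd : MDifferentiableAt 𝓘(ℝ, E) 𝓘(ℝ, E) (flow X t) x) :
    tangentFlow X t x (X x) = X (flow X t x) := by
  have h1 := (flow_spec hX x).2 0
  have h2 := (flow_spec hX (flow X t x)).2 0
  have hd' : HasMFDerivAt 𝓘(ℝ, E) 𝓘(ℝ, E) (flow X t) (flow X 0 x)
      (mfderiv 𝓘(ℝ, E) 𝓘(ℝ, E) (flow X t) (flow X 0 x)) := by
    rw [flow_zero hX]
    exact hd.hasMFDerivAt
  have h3 := hd'.comp (0 : ℝ) h1
  have h4 : (flow X t ∘ fun s => flow X s x) = fun s => flow X s (flow X t x) := by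
    funext s
    rw [Function.comp_apply, ← flow_add hX, ← flow_add hX, add_comm]
  rw [h4] at h3
  have h5 := DFunLike.congr_fun (hasMFDerivAt_unique h3 h2) (1 : ℝ)
  have h5' : mfderiv 𝓘(ℝ, E) 𝓘(ℝ, E) (flow X t) (flow X 0 x) ((1 : ℝ) • X (flow X 0 x)) =
    (1 : ℝ) • X (flow X 0 (flow X t x)) := h5
  have h6 : mfderiv 𝓘(ℝ, E) 𝓘(ℝ, E) (flow X t) (flow X 0 x) (X (flow X 0 x)) =
    X (flow X 0 (flow X t x)) := by rwa [one_smul, one_smul] at h5'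
  -- The base points `flow X 0 x` and `x` are only propositionally equal. The equality of vectors is
  -- stated in `E` and transported by substituting variables.
  have h7 : ∀ y z : M, y = x → z = flow X t x →
      (mfderiv 𝓘(ℝ, E) 𝓘(ℝ, E) (flow X t) y (X y) : E) = (X z : E) →
      (mfderiv 𝓘(ℝ, E) 𝓘(ℝ, E) (flow X t) x (X x) : E) = (X (flow X t x) : E) := by
    rintro y z rfl rfl h
    exact h
  exact h7 _ _ (flow_zero hX x) (flow_zero hX _) h6

end FlowGroup

/-! ### The flow near a singularity, modelled on `E` -/

section LocalModel

variable {E : Type*} [NormedAddCommGroup E] [NormedSpace ℝ E]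
  {M : Type*} [TopologicalSpace M] [ChartedSpace E M]

/-- `φ` is a `C^1` flow on the model space which represents the flow of `X`, in the chart at the
singularity `σ`, during arbitrarily long times for points close enough to `σ`. -/
structure IsLocalFlowModel (X : (x : M) → TangentSpace 𝓘(ℝ, E) x) (σ : M) (φ : ℝ → E → E) :
    Prop where
  contDiff : ∀ t, ContDiff ℝ 1 (φ t)
  zero : ∀ z, φ 0 z = z
  add : ∀ s t z, φ (s + t) z = φ s (φ t z)
  apply_base : ∀ t, φ t (extChartAt 𝓘(ℝ, E) σ σ) = extChartAt 𝓘(ℝ, E) σ σ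
  bound : ∃ K : ℝ, 0 ≤ K ∧ ∀ t z, ‖fderiv ℝ (φ t) z‖ ≤ Real.exp (K * |t|)
  eventually_mem : ∀ S : ℝ, ∀ W ∈ 𝓝 σ, ∀ᶠ y in 𝓝 σ, ∀ t, |t| ≤ S → flow X t y ∈ W
  eventually_mdifferentiableAt : ∀ S : ℝ, ∀ᶠ y in 𝓝 σ, ∀ t, |t| ≤ S →
    MDifferentiableAt 𝓘(ℝ, E) 𝓘(ℝ, E) (flow X t) y
  eventually_chartDeriv : ∀ S : ℝ, ∀ᶠ y in 𝓝 σ, ∀ t, |t| ≤ S → ∀ v : TangentSpace 𝓘(ℝ, E) y,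
    chartDeriv E σ (flow X t y) (tangentFlow X t y v) =
      fderiv ℝ (φ t) (extChartAt 𝓘(ℝ, E) σ y) (chartDeriv E σ y v)

variable [FiniteDimensional ℝ E] [T2Space M] [CompactSpace M] [IsManifold 𝓘(ℝ, E) 1 M]
  {X : (x : M) → TangentSpace 𝓘(ℝ, E) x}

theorem exists_isLocalFlowModel
    (hX : ContMDiff 𝓘(ℝ, E) 𝓘(ℝ, E).tangent 1
      (fun x => (⟨x, X x⟩ : TangentBundle 𝓘(ℝ, E) M))) {σ : M} (hσ : X σ = 0) :
    ∃ φ : ℝ → E → E, IsLocalFlowModel X σ φ := by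
  have : CompleteSpace E := FiniteDimensional.complete ℝ E
  set e := extChartAt 𝓘(ℝ, E) σ with he
  set p := e σ with hp
  have hep : e.symm p = σ := extChartAt_to_inv σ
  obtain ⟨f, hf, hfs, hfX⟩ := (contDiffAt_chartField hX σ).exists_contDiff_hasCompactSupport
  obtain ⟨K, hK⟩ := hf.lipschitzWith_of_hasCompactSupport hfs one_ne_zero
  obtain ⟨φ, hφ⟩ := exists_isGlobalFlow hf hfs
  have hfp : f p = 0 := by
    rw [hfX.self_of_nhds, chartField, ← he, hep, hσ, map_zero]
  have hφp : ∀ t, φ t p = p := hφ.apply_eq_of_zero hK hfp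
  obtain ⟨ρ, hρ, hball⟩ := Metric.eventually_nhds_iff_ball.1
    (hfX.and (extChartAt_target_mem_nhds (I := 𝓘(ℝ, E)) σ))
  -- `p` is fixed and distances grow at most by `exp (K * S)` up to time `S`.
  have hstay : ∀ S, ∀ r > 0, ∀ᶠ y in 𝓝 σ, ∀ t, |t| ≤ S → φ t (e y) ∈ Metric.ball p r := by
    intro S r hr
    have h1 : Tendsto (fun y => Real.exp (K * S) * dist (e y) p) (𝓝 σ)
        (𝓝 (Real.exp (K * S) * dist (e σ) p)) :=
      ((continuousAt_extChartAt σ).dist continuousAt_const).const_mul _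
    rw [dist_self, mul_zero] at h1
    filter_upwards [h1.eventually_lt_const hr] with y hy t ht
    have h2 := hφ.dist_le hK t (e y) p
    rw [hφp] at h2
    refine (h2.trans ?_).trans_lt hy
    gcongr
  have hflow : ∀ S, ∀ᶠ y in 𝓝 σ, ∀ t, |t| ≤ S →
      φ t (e y) ∈ Metric.ball p ρ ∧ flow X t y = e.symm (φ t (e y)) := by
    intro S
    filter_upwards [hstay (|S| + 1) ρ hρ, extChartAt_source_mem_nhds (I := 𝓘(ℝ, E)) σ] with y hy hys
    have hS : 0 < |S| + 1 := by positivity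
    have hin : ∀ t ∈ Set.Ioo (-(|S| + 1)) (|S| + 1), φ t (e y) ∈ Metric.ball p ρ :=
      fun t ht => hy t (abs_le.2 ⟨ht.1.le, ht.2.le⟩)
    have hcurve : IsMIntegralCurveOn (I := 𝓘(ℝ, E)) (e.symm ∘ fun t => φ t (e y)) X
        (Set.Ioo (-(|S| + 1)) (|S| + 1)) := by
      apply isMIntegralCurveOn_symm_comp
      · intro t ht
        have := hφ.hasDerivAt (e y) t
        rwa [(hball _ (hin t ht)).1] at this
      · exact fun t ht => (hball _ (hin t ht)).2
    have heq := isMIntegralCurveOn_Ioo_eqOn_of_contMDiff_boundaryless (t₀ := 0)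
      ⟨by linarith, hS⟩ hX ((flow_spec hX y).2.isMIntegralCurveOn _) hcurve
      (by simp only [Function.comp_apply, hφ.zero, flow_zero hX]; exact (e.left_inv hys).symm)
    intro t ht
    have ht' : t ∈ Set.Ioo (-(|S| + 1)) (|S| + 1) := by
      have := ht.trans (le_abs_self S)
      rw [abs_le] at this
      exact ⟨by linarith, by linarith⟩
    exact ⟨hin t ht', heq ht'⟩
  have hsrc : ∀ z ∈ Metric.ball p ρ, e.symm z ∈ e.source := fun z hz => e.map_target (hball z hz).2
  -- The identity with the model flow holds on a neighbourhood of `y`, not only at `y`, so it can be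
  -- differentiated.
  have hd : ∀ S, ∀ᶠ y in 𝓝 σ, ∀ t, |t| ≤ S →
      MDifferentiableAt 𝓘(ℝ, E) 𝓘(ℝ, E) (flow X t) y ∧ flow X t y ∈ e.source ∧
      (e ∘ flow X t) =ᶠ[𝓝 y] (φ t ∘ e) := by
    intro S
    filter_upwards [eventually_eventually_nhds.2 (hflow S),
      extChartAt_source_mem_nhds (I := 𝓘(ℝ, E)) σ] with y hy hys t ht
    have hyt := hy.self_of_nhds t ht
    have hsymm : MDifferentiableAt 𝓘(ℝ, E) 𝓘(ℝ, E) e.symm (φ t (e y)) := by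
      have := mdifferentiableWithinAt_extChartAt_symm (I := 𝓘(ℝ, E)) (hball _ hyt.1).2
      rwa [modelWithCornersSelf_coe, Set.range_id, mdifferentiableWithinAt_univ] at this
    have hφt : MDifferentiableAt 𝓘(ℝ, E) 𝓘(ℝ, E) (φ t) (e y) :=
      ((hφ.contDiff hf hfs t).differentiable one_ne_zero).differentiableAt.mdifferentiableAt
    have hey : MDifferentiableAt 𝓘(ℝ, E) 𝓘(ℝ, E) e y :=
      mdifferentiableAt_extChartAt (by rwa [← extChartAt_source (I := 𝓘(ℝ, E))])
    have h1 : MDifferentiableAt 𝓘(ℝ, E) 𝓘(ℝ, E) (e.symm ∘ φ t ∘ e) y :=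
      hsymm.comp y (hφt.comp y hey)
    refine ⟨h1.congr_of_eventuallyEq ?_, ?_, ?_⟩
    · filter_upwards [hy] with w hw using (hw t ht).2
    · rw [hyt.2]
      exact hsrc _ hyt.1
    · filter_upwards [hy] with w hw
      rw [Function.comp_apply, (hw t ht).2]
      exact e.right_inv (hball _ (hw t ht).1).2
  refine ⟨φ, hφ.contDiff hf hfs, hφ.zero, hφ.add hK, hφp, ⟨K, K.2, hφ.norm_fderiv_le hK⟩, ?_,
    fun S => (hd S).mono fun y hy t ht => (hy t ht).1, ?_⟩
  · intro S W hW
    have h1 : ∀ᶠ z in 𝓝 p, e.symm z ∈ W := by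
      have := continuousAt_extChartAt_symm (I := 𝓘(ℝ, E)) σ
      apply this.eventually_mem
      rwa [extChartAt_to_inv]
    obtain ⟨r, hr, hrW⟩ := Metric.eventually_nhds_iff_ball.1 h1
    filter_upwards [hflow S, hstay S r hr] with y hy hyr t ht
    rw [(hy t ht).2]
    exact hrW _ (hyr t ht)
  · intro S
    filter_upwards [hd S, extChartAt_source_mem_nhds (I := 𝓘(ℝ, E)) σ] with y hy hys t ht v
    obtain ⟨h1, h2, h3⟩ := hy t ht
    have hey : MDifferentiableAt 𝓘(ℝ, E) 𝓘(ℝ, E) e y :=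
      mdifferentiableAt_extChartAt (by rwa [← extChartAt_source (I := 𝓘(ℝ, E))])
    have hef : MDifferentiableAt 𝓘(ℝ, E) 𝓘(ℝ, E) e (flow X t y) :=
      mdifferentiableAt_extChartAt (by rwa [← extChartAt_source (I := 𝓘(ℝ, E))])
    have hφt : MDifferentiableAt 𝓘(ℝ, E) 𝓘(ℝ, E) (φ t) (e y) :=
      ((hφ.contDiff hf hfs t).differentiable one_ne_zero).differentiableAt.mdifferentiableAt
    have h4 := hef.hasMFDerivAt.comp y h1.hasMFDerivAt
    have h5 := (hφt.hasMFDerivAt.comp y hey.hasMFDerivAt).congr_of_eventuallyEq h3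
    have h6 := DFunLike.congr_fun (hasMFDerivAt_unique h4 h5) v
    rw [mfderiv_eq_fderiv] at h6
    exact h6

end LocalModel

/-- Pythagoras. Later estimates may thus use any convenient multiple of `x` in place of the exact
projection. -/
theorem norm_sub_inner_div_smul_le {F : Type*} [NormedAddCommGroup F] [InnerProductSpace ℝ F]
    (v x : F) (c : ℝ) : ‖v - (inner ℝ v x / ‖x‖ ^ 2) • x‖ ≤ ‖v - c • x‖ := by
  rcases eq_or_ne x 0 with rfl | hx
  · simp
  set a := inner ℝ v x / ‖x‖ ^ 2 with ha
  have hx2 : ‖x‖ ^ 2 ≠ 0 := by simpa using hx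
  have horth : inner ℝ (v - a • x) ((a - c) • x) = 0 := by
    rw [real_inner_smul_right, inner_sub_left, real_inner_smul_left, real_inner_self_eq_norm_sq,
      ha, div_mul_cancel₀ _ hx2, sub_self, mul_zero]
  have e : v - c • x = (v - a • x) + (a - c) • x := by rw [sub_smul]; abel
  have h := norm_add_sq_eq_norm_sq_add_norm_sq_of_inner_eq_zero _ _ horth
  rw [← e] at h
  nlinarith [norm_nonneg (v - a • x), norm_nonneg (v - c • x), norm_nonneg ((a - c) • x)]

/-! ### Transversal contraction along orbits -/

section Transversal

variable {E : Type*} [NormedAddCommGroup E] [NormedSpace ℝ E]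
  {M : Type*} [TopologicalSpace M] [ChartedSpace E M]

theorem tangentFlow_add_apply [CompleteSpace E] [T2Space M] [CompactSpace M]
    [IsManifold 𝓘(ℝ, E) 1 M] {X : (x : M) → TangentSpace 𝓘(ℝ, E) x}
    (hX : ContMDiff 𝓘(ℝ, E) 𝓘(ℝ, E).tangent 1
      (fun x => (⟨x, X x⟩ : TangentBundle 𝓘(ℝ, E) M))) {s t : ℝ} {y : M}
    (ht : MDifferentiableAt 𝓘(ℝ, E) 𝓘(ℝ, E) (flow X t) y)
    (hs : MDifferentiableAt 𝓘(ℝ, E) 𝓘(ℝ, E) (flow X s) (flow X t y)) (v : E) :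
    (tangentFlow X (s + t) y v : E) = tangentFlow X s (flow X t y) (tangentFlow X t y v) := by
  have h : ∀ g : M → M, g = flow X s ∘ flow X t →
      (mfderiv 𝓘(ℝ, E) 𝓘(ℝ, E) g y v : E) =
        tangentFlow X s (flow X t y) (tangentFlow X t y v) := by
    rintro _ rfl
    rw [mfderiv_comp y hs ht]
    rfl
  exact h _ (funext fun z => flow_add hX s t z)

theorem apply_flow_ne_zero [CompleteSpace E] [T2Space M] [CompactSpace M]
    [IsManifold 𝓘(ℝ, E) 1 M] {X : (x : M) → TangentSpace 𝓘(ℝ, E) x}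
    (hX : ContMDiff 𝓘(ℝ, E) 𝓘(ℝ, E).tangent 1
      (fun x => (⟨x, X x⟩ : TangentBundle 𝓘(ℝ, E) M))) {y : M} (hy : X y ≠ 0) (t : ℝ) :
    X (flow X t y) ≠ 0 := by
  intro h
  have h1 := flow_eq_self_of_eq_zero hX h (-t)
  rw [← flow_add hX, neg_add_cancel, flow_zero hX] at h1
  rw [← h1] at h
  exact hy h

variable [RiemannianBundle (fun x : M => TangentSpace 𝓘(ℝ, E) x)]

/-- The norm of the component of `v` orthogonal to `X(y)`. -/
def transversalNorm (X : (x : M) → TangentSpace 𝓘(ℝ, E) x) (y : M)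
    (v : TangentSpace 𝓘(ℝ, E) y) : ℝ :=
  ‖v - (inner ℝ v (X y) / ‖X y‖ ^ 2) • X y‖

/-- Relatively to the norm of `X`, the transversal norm is multiplied by at most `ρ` along the
orbit of `y` during the time `t`. -/
def ContractsBy (X : (x : M) → TangentSpace 𝓘(ℝ, E) x) (t : ℝ) (y : M) (ρ : ℝ) : Prop :=
  ∀ v : TangentSpace 𝓘(ℝ, E) y, transversalNorm X (flow X t y) (tangentFlow X t y v) * ‖X y‖ ≤
    ρ * transversalNorm X y v * ‖X (flow X t y)‖

variable {X : (x : M) → TangentSpace 𝓘(ℝ, E) x}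

theorem transversalNorm_nonneg (y : M) (v : TangentSpace 𝓘(ℝ, E) y) :
    0 ≤ transversalNorm X y v := norm_nonneg _

theorem transversalNorm_le (y : M) (v : TangentSpace 𝓘(ℝ, E) y) (c : ℝ) :
    transversalNorm X y v ≤ ‖v - c • X y‖ := norm_sub_inner_div_smul_le v (X y) c

theorem transversalNorm_le_norm (y : M) (v : TangentSpace 𝓘(ℝ, E) y) :
    transversalNorm X y v ≤ ‖v‖ := by
  simpa using transversalNorm_le (X := X) y v 0

/-- Removing the `X`-component of `v` changes its image only by a multiple of `X (flow X t y)`, so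
the transversal part of the image is `ψ_t` of the normal part of `v`. -/
theorem contractsBy_norm_rescaledPoincareFlow {t : ℝ} {y : M}
    (hs : tangentFlow X t y (X y) = X (flow X t y)) (hy : X y ≠ 0) (hyt : X (flow X t y) ≠ 0) :
    ContractsBy X t y ‖rescaledPoincareFlow X t y‖ := by
  intro v
  set a := inner ℝ v (X y) / ‖X y‖ ^ 2 with ha
  have hx2 : ‖X y‖ ^ 2 ≠ 0 := by simpa using hy
  have hmem : v - a • X y ∈ normalSpace X y := by
    change inner ℝ (v - a • X y) (X y) = 0
    rw [inner_sub_left, real_inner_smul_left, real_inner_self_eq_norm_sq, ha,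
      div_mul_cancel₀ _ hx2, sub_self]
  have h1 := (rescaledPoincareFlow X t y).le_opNorm ⟨v - a • X y, hmem⟩
  have h2 : ‖rescaledPoincareFlow X t y ⟨v - a • X y, hmem⟩‖ =
      ‖X y‖ / ‖X (flow X t y)‖ * ‖projectedTangentFlow X t y (v - a • X y)‖ := by
    have : ‖rescaledPoincareFlow X t y ⟨v - a • X y, hmem⟩‖ =
      ‖(‖X y‖ / ‖X (flow X t y)‖) • projectedTangentFlow X t y (v - a • X y)‖ := rfl
    rw [this, norm_smul, Real.norm_of_nonneg (by positivity)]
  have h3 : transversalNorm X (flow X t y) (tangentFlow X t y v) ≤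
      ‖projectedTangentFlow X t y (v - a • X y)‖ := by
    have h4 := transversalNorm_le (X := X) (flow X t y) (tangentFlow X t y v)
      (a + inner ℝ (tangentFlow X t y (v - a • X y)) (X (flow X t y)) / ‖X (flow X t y)‖ ^ 2)
    rw [add_smul, ← sub_sub] at h4
    rw [projectedTangentFlow_apply]
    have h5 : tangentFlow X t y (v - a • X y) = tangentFlow X t y v - a • X (flow X t y) := by
      rw [map_sub, map_smul, hs]
    rw [h5] at h4 ⊢
    exact h4
  have hpos : 0 < ‖X (flow X t y)‖ := norm_pos_iff.2 hyt
  rw [h2, div_mul_eq_mul_div, div_le_iff₀ hpos] at h1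
  calc _ ≤ ‖projectedTangentFlow X t y (v - a • X y)‖ * ‖X y‖ := by gcongr
    _ = ‖X y‖ * ‖projectedTangentFlow X t y (v - a • X y)‖ := mul_comm _ _
    _ ≤ _ := h1

theorem ContractsBy.mono {t : ℝ} {y : M} {ρ ρ' : ℝ} (h : ContractsBy X t y ρ) (hρ : ρ ≤ ρ') :
    ContractsBy X t y ρ' := fun v => (h v).trans (by
  gcongr
  exact transversalNorm_nonneg y v)

theorem contractsBy_of_norm_le {t : ℝ} {y : M} {b : ℝ} (hb : 0 ≤ b)
    (hs : tangentFlow X t y (X y) = X (flow X t y))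
    (hv : ∀ v, ‖tangentFlow X t y v‖ ≤ b * ‖v‖) (hx : ‖X y‖ ≤ b * ‖X (flow X t y)‖) :
    ContractsBy X t y (b * b) := by
  intro v
  set a := inner ℝ v (X y) / ‖X y‖ ^ 2 with ha
  have h1 : transversalNorm X (flow X t y) (tangentFlow X t y v) ≤ b * transversalNorm X y v := by
    refine (transversalNorm_le (X := X) (flow X t y) (tangentFlow X t y v) a).trans ?_
    have h5 : tangentFlow X t y v - a • X (flow X t y) = tangentFlow X t y (v - a • X y) := by
      rw [map_sub, map_smul, hs]
    rw [h5]
    exact hv _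
  have := transversalNorm_nonneg (X := X) y v
  calc _ ≤ (b * transversalNorm X y v) * (b * ‖X (flow X t y)‖) := by gcongr
    _ = _ := by ring

variable [CompleteSpace E] [T2Space M] [CompactSpace M] [IsManifold 𝓘(ℝ, E) 1 M]

theorem contractsBy_zero
    (hX : ContMDiff 𝓘(ℝ, E) 𝓘(ℝ, E).tangent 1
      (fun x => (⟨x, X x⟩ : TangentBundle 𝓘(ℝ, E) M))) (y : M) : ContractsBy X 0 y 1 := by
  intro v
  have hid : flow X 0 = id := funext fun z => flow_zero hX z
  have h : ∀ g : M → M, g = id → transversalNorm X (g y) (mfderiv 𝓘(ℝ, E) 𝓘(ℝ, E) g y v) * ‖X y‖ ≤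
      1 * transversalNorm X y v * ‖X (g y)‖ := by
    rintro _ rfl
    rw [mfderiv_id, one_mul]
    rfl
  exact h _ hid

/-- The ratios of `‖X‖` telescope along the orbit: the intermediate factor `‖X (flow X t y)‖`
cancels. -/
theorem ContractsBy.add
    (hX : ContMDiff 𝓘(ℝ, E) 𝓘(ℝ, E).tangent 1
      (fun x => (⟨x, X x⟩ : TangentBundle 𝓘(ℝ, E) M))) {s t : ℝ} {y : M} {ρ ρ' : ℝ}
    (h : ContractsBy X t y ρ) (h' : ContractsBy X s (flow X t y) ρ') (hρ' : 0 ≤ ρ')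
    (ht : MDifferentiableAt 𝓘(ℝ, E) 𝓘(ℝ, E) (flow X t) y)
    (hs : MDifferentiableAt 𝓘(ℝ, E) 𝓘(ℝ, E) (flow X s) (flow X t y)) (hy : X y ≠ 0) :
    ContractsBy X (s + t) y (ρ' * ρ) := by
  intro v
  have hpos : 0 < ‖X (flow X t y)‖ := norm_pos_iff.2 (apply_flow_ne_zero hX hy t)
  have h1 := h v
  have h2 := h' (tangentFlow X t y v)
  have h3 : ∀ (z : M) (w : TangentSpace 𝓘(ℝ, E) z), z = flow X s (flow X t y) →
      (w : E) = tangentFlow X s (flow X t y) (tangentFlow X t y v) →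
      transversalNorm X z w * ‖X y‖ ≤ ρ' * ρ * transversalNorm X y v * ‖X z‖ := by
    rintro z w rfl hw
    change w = tangentFlow X s (flow X t y) (tangentFlow X t y v) at hw
    subst hw
    refine le_of_mul_le_mul_right ?_ hpos
    calc _ = (transversalNorm X _ (tangentFlow X s (flow X t y) (tangentFlow X t y v)) *
            ‖X (flow X t y)‖) * ‖X y‖ := by ring
      _ ≤ (ρ' * transversalNorm X (flow X t y) (tangentFlow X t y v) *
            ‖X (flow X s (flow X t y))‖) * ‖X y‖ := by gcongr
      _ = ρ' * ‖X (flow X s (flow X t y))‖ *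
            (transversalNorm X (flow X t y) (tangentFlow X t y v) * ‖X y‖) := by ring
      _ ≤ ρ' * ‖X (flow X s (flow X t y))‖ *
            (ρ * transversalNorm X y v * ‖X (flow X t y)‖) := by gcongr
      _ = _ := by ring
  exact h3 _ _ (flow_add hX s t y) (tangentFlow_add_apply hX ht hs v)

end Transversal

/-! ### Uniform estimates near the singularity -/

section Decay

variable {E : Type*} [NormedAddCommGroup E] [NormedSpace ℝ E]
  {M : Type*} [TopologicalSpace M] [ChartedSpace E M] [IsManifold 𝓘(ℝ, E) 1 M]
  [RiemannianBundle (fun x : M => TangentSpace 𝓘(ℝ, E) x)]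
  [IsContinuousRiemannianBundle E (fun x : M => TangentSpace 𝓘(ℝ, E) x)]

/-- Near `σ`, the Riemannian norm is equivalent to the norm read in the chart at `σ`. -/
theorem exists_norm_chartDeriv_bounds (σ : M) :
    ∃ κ > (0 : ℝ), ∀ᶠ y in 𝓝 σ, ∀ v : TangentSpace 𝓘(ℝ, E) y,
      ‖chartDeriv E σ y v‖ ≤ κ * ‖v‖ ∧ ‖v‖ ≤ κ * ‖chartDeriv E σ y v‖ := by
  obtain ⟨C₁, hC₁, h₁⟩ := eventually_norm_trivializationAt_lt E
    (fun x : M => TangentSpace 𝓘(ℝ, E) x) σ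
  obtain ⟨C₂, hC₂, h₂⟩ := eventually_norm_symmL_trivializationAt_lt E
    (fun x : M => TangentSpace 𝓘(ℝ, E) x) σ
  refine ⟨max C₁ C₂, lt_max_of_lt_left hC₁, ?_⟩
  filter_upwards [h₁, h₂, chart_source_mem_nhds E σ] with y hy₁ hy₂ hy v
  set e := trivializationAt E (fun x : M => TangentSpace 𝓘(ℝ, E) x) σ with he
  have hcd : ∀ v, chartDeriv E σ y v = e.continuousLinearMapAt ℝ y v := fun v =>
    (DFunLike.congr_fun (TangentBundle.continuousLinearMapAt_trivializationAt hy) v).symm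
  have hbase : y ∈ e.baseSet := by
    rw [he, TangentBundle.trivializationAt_baseSet]
    exact hy
  rw [hcd]
  constructor
  · refine (ContinuousLinearMap.le_of_opNorm_le _ hy₁.le v).trans ?_
    gcongr
    exact le_max_left _ _
  · have h3 : e.symmL ℝ y (e.continuousLinearMapAt ℝ y v) = v :=
      e.symmL_continuousLinearMapAt hbase v
    have h4 := ContinuousLinearMap.le_of_opNorm_le _ hy₂.le (e.continuousLinearMapAt ℝ y v)
    rw [h3] at h4
    refine h4.trans ?_
    gcongr
    exact le_max_right _ _

variable {X : (x : M) → TangentSpace 𝓘(ℝ, E) x} {σ : M} {φ : ℝ → E → E}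

theorem IsLocalFlowModel.exists_norm_tangentFlow_le (hφ : IsLocalFlowModel X σ φ) (S : ℝ) :
    ∃ b : ℝ, 0 ≤ b ∧ ∀ᶠ y in 𝓝 σ, ∀ t, |t| ≤ S → ∀ v, ‖tangentFlow X t y v‖ ≤ b * ‖v‖ := by
  obtain ⟨κ, hκ, hκy⟩ := exists_norm_chartDeriv_bounds (E := E) σ
  obtain ⟨K, hK, hKb⟩ := hφ.bound
  refine ⟨κ * Real.exp (K * S) * κ, by positivity, ?_⟩
  filter_upwards [hκy, hφ.eventually_mem S _ hκy, hφ.eventually_chartDeriv S] with y h1 h2 h3 t ht v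
  calc ‖tangentFlow X t y v‖ ≤ κ * ‖chartDeriv E σ (flow X t y) (tangentFlow X t y v)‖ :=
        (h2 t ht _).2
    _ ≤ κ * (Real.exp (K * S) * (κ * ‖v‖)) := by
        rw [h3 t ht v]
        gcongr
        refine (ContinuousLinearMap.le_of_opNorm_le _ (hKb t _) _).trans ?_
        gcongr
        exact (h1 v).1
    _ = _ := by ring

variable [FiniteDimensional ℝ E] [T2Space M] [CompactSpace M]

theorem IsLocalFlowModel.exists_contractsBy (hφ : IsLocalFlowModel X σ φ)
    (hX : ContMDiff 𝓘(ℝ, E) 𝓘(ℝ, E).tangent 1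
      (fun x => (⟨x, X x⟩ : TangentBundle 𝓘(ℝ, E) M))) (S : ℝ) :
    ∃ B : ℝ, 0 ≤ B ∧ ∀ᶠ y in 𝓝 σ, ∀ t, |t| ≤ S → ContractsBy X t y B := by
  have : CompleteSpace E := FiniteDimensional.complete ℝ E
  obtain ⟨b, hb, hby⟩ := hφ.exists_norm_tangentFlow_le S
  refine ⟨b * b, by positivity, ?_⟩
  have hd := hφ.eventually_mdifferentiableAt S
  filter_upwards [hby, hd, hφ.eventually_mem S _ (hby.and hd)] with y h1 h2 h3 t ht
  refine contractsBy_of_norm_le hb (tangentFlow_self hX (h2 t ht)) (h1 t ht) ?_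
  have ht' : |-t| ≤ S := by rwa [abs_neg]
  -- Flowing `X (flow X t y)` back by `-t` recovers `X y`, so `‖X‖` cannot shrink by more than `b`.
  have h4 := (h3 t ht).1 (-t) ht' (X (flow X t y))
  rw [tangentFlow_self hX ((h3 t ht).2 (-t) ht')] at h4
  have h5 : ∀ z, z = y → ‖X z‖ ≤ b * ‖X (flow X t y)‖ → ‖X y‖ ≤ b * ‖X (flow X t y)‖ := by
    rintro _ rfl h
    exact h
  exact h5 _ (by rw [← flow_add hX, neg_add_cancel, flow_zero hX]) h4

/-- The product hypothesis covers the time up to the last `τ n ≤ t`; the remaining time is at most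
`T` and is absorbed in a constant. The neighbourhood of `σ` depends on `t`, but `B` does not. -/
theorem IsLocalFlowModel.exists_contractsBy_exp (hφ : IsLocalFlowModel X σ φ)
    (hX : ContMDiff 𝓘(ℝ, E) 𝓘(ℝ, E).tangent 1
      (fun x => (⟨x, X x⟩ : TangentBundle 𝓘(ℝ, E) M))) (C : ℝ) {η T : ℝ} (hη : 0 < η) :
    ∃ B : ℝ, 0 ≤ B ∧ ∀ t, 0 ≤ t → ∀ᶠ y in 𝓝 σ, IsContracted X C η T y →
      ContractsBy X t y (B * Real.exp (-η * t)) := by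
  have : CompleteSpace E := FiniteDimensional.complete ℝ E
  obtain ⟨b, hb, hby⟩ := hφ.exists_contractsBy hX T
  -- `b` pays for the remaining time, `max C 1` covers the empty product when `n = 0`, and `exp (η *
  -- T)` replaces `τ n` by `t` in the rate.
  refine ⟨b * max C 1 * Real.exp (η * T), by positivity, fun t ht => ?_⟩
  have hd := hφ.eventually_mdifferentiableAt T
  filter_upwards [hφ.eventually_mem t _ (hby.and hd), hφ.eventually_mdifferentiableAt t]
    with y h1 h2
  rintro ⟨hy, τ, hτ0, hτ, hτT, hτtop, hprod⟩
  have hτnn : ∀ n, 0 ≤ τ n := fun n => hτ0 ▸ hτ.monotone (Nat.zero_le n)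
  have hiter : ∀ n, τ n ≤ t → ContractsBy X (τ n) y
      (∏ i ∈ Finset.range n, ‖rescaledPoincareFlow X (τ (i + 1) - τ i) (flow X (τ i) y)‖) := by
    intro n
    induction n with
    | zero =>
      intro _
      rw [hτ0, Finset.prod_range_zero]
      exact contractsBy_zero hX y
    | succ n ih =>
      intro hn
      have hlt := hτ (Nat.lt_succ_self n)
      have hn' : τ n ≤ t := hlt.le.trans hn
      have habs : |τ n| ≤ t := by rwa [abs_of_nonneg (hτnn n)]
      have hs : |τ (n + 1) - τ n| ≤ T := by
        rw [abs_of_pos (sub_pos.2 hlt)]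
        exact hτT n
      have hds := (h1 _ habs).2 _ hs
      have hyn := apply_flow_ne_zero hX hy (τ n)
      rw [Finset.prod_range_succ, mul_comm]
      have := (ih hn').add hX (contractsBy_norm_rescaledPoincareFlow (tangentFlow_self hX hds) hyn
        (apply_flow_ne_zero hX hyn _)) (ContinuousLinearMap.opNorm_nonneg _) (h2 _ habs) hds hy
      rwa [sub_add_cancel] at this
  obtain ⟨N, hN⟩ := (hτtop.eventually_gt_atTop t).exists
  have hex : ∃ n, t < τ n := ⟨N, hN⟩
  classical
  set m := Nat.find hex with hm
  have hm1 : t < τ m := Nat.find_spec hex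
  have hm0 : m ≠ 0 := by
    intro h
    rw [h, hτ0] at hm1
    linarith
  obtain ⟨n, hn⟩ := Nat.exists_eq_succ_of_ne_zero hm0
  have hnt : τ n ≤ t := not_lt.1 (Nat.find_min hex (by omega))
  have hnT : t - τ n ≤ T := by
    have := hτT n
    rw [hn] at hm1
    simp only [Nat.succ_eq_add_one] at hm1
    linarith
  have habs : |τ n| ≤ t := by rwa [abs_of_nonneg (hτnn n)]
  have hs : |t - τ n| ≤ T := by rwa [abs_of_nonneg (sub_nonneg.2 hnt)]
  have hc : ContractsBy X (τ n) y (max C 1 * Real.exp (-η * τ n)) := by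
    refine (hiter n hnt).mono ?_
    rcases Nat.eq_zero_or_pos n with h0 | h0
    · rw [h0, hτ0]
      simp
    · refine (hprod n h0).trans ?_
      gcongr
      exact le_max_left _ _
  have hfin := hc.add hX ((h1 _ habs).1 _ hs) hb (h2 _ habs) ((h1 _ habs).2 _ hs) hy
  rw [sub_add_cancel] at hfin
  refine hfin.mono ?_
  rw [mul_assoc, mul_assoc, ← Real.exp_add]
  gcongr
  nlinarith

end Decay

/-! ### Passage to the limit at the singularity -/

/-- The condition of being at bounded distance from a line passes to the limit. -/
theorem exists_norm_sub_smul_le_of_tendsto {ι V : Type*} [NormedAddCommGroup V] [NormedSpace ℝ V]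
    {l : Filter ι} [l.NeBot] {a w : ι → V} {r : ι → ℝ} {a₀ w₀ : V} {r₀ : ℝ}
    (ha : Tendsto a l (𝓝 a₀)) (hw : Tendsto w l (𝓝 w₀)) (hr : Tendsto r l (𝓝 r₀)) (hw₀ : w₀ ≠ 0)
    (h : ∀ᶠ i in l, ∃ c : ℝ, ‖a i - c • w i‖ ≤ r i) : ∃ c : ℝ, ‖a₀ - c • w₀‖ ≤ r₀ := by
  obtain ⟨c, hc⟩ := h.choice
  set R := (r₀ + ‖a₀‖) / ‖w₀‖ + 1
  have hlim : Tendsto (fun i => (r i + ‖a i‖) / ‖w i‖) l (𝓝 ((r₀ + ‖a₀‖) / ‖w₀‖)) :=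
    (hr.add ha.norm).div hw.norm (norm_ne_zero_iff.2 hw₀)
  -- The coefficients stay bounded because `|c i| ‖w i‖ ≤ r i + ‖a i‖` and `w₀ ≠ 0`, so they
  -- converge along an ultrafilter.
  have hbd : ∀ᶠ i in l, c i ∈ Metric.closedBall (0 : ℝ) R := by
    filter_upwards [hc, hlim.eventually_lt_const (lt_add_one _), hw.eventually_ne hw₀]
      with i h1 h2 h3
    rw [mem_closedBall_zero_iff]
    refine le_trans ?_ h2.le
    rw [le_div_iff₀ (norm_pos_iff.2 h3), ← norm_smul]
    have h4 := norm_sub_le (a i) (a i - c i • w i)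
    rw [sub_sub_cancel] at h4
    linarith
  have hG : ((Ultrafilter.of l).map c : Filter ℝ) ≤ 𝓟 (Metric.closedBall (0 : ℝ) R) :=
    le_principal_iff.2 (hbd.filter_mono (Ultrafilter.of_le l))
  obtain ⟨c₀, -, hc₀⟩ := (isCompact_closedBall (0 : ℝ) R).ultrafilter_le_nhds _ hG
  have hcl : Tendsto c (Ultrafilter.of l) (𝓝 c₀) := hc₀
  have hle := Ultrafilter.of_le l
  refine ⟨c₀, le_of_tendsto_of_tendsto ((ha.mono_left hle).sub
    (hcl.smul (hw.mono_left hle))).norm (hr.mono_left hle) (hc.filter_mono hle)⟩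

section Limit

variable {E : Type*} [NormedAddCommGroup E] [NormedSpace ℝ E]
  {M : Type*} [TopologicalSpace M] [ChartedSpace E M]
  {X : (x : M) → TangentSpace 𝓘(ℝ, E) x} {σ : M} {φ : ℝ → E → E}

theorem IsLocalFlowModel.isLinearFlow (hφ : IsLocalFlowModel X σ φ) :
    IsLinearFlow fun t => fderiv ℝ (φ t) (extChartAt 𝓘(ℝ, E) σ σ) := by
  have hd : ∀ t z, DifferentiableAt ℝ (φ t) z := fun t z =>
    (hφ.contDiff t).differentiable one_ne_zero z
  refine ⟨fun v => ?_, fun s t v => ?_, ?_⟩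
  · have h0 : φ 0 = id := funext hφ.zero
    rw [h0, fderiv_id]
    rfl
  · have h1 : φ (s + t) = φ s ∘ φ t := funext (hφ.add s t)
    rw [h1, fderiv_comp _ (hd _ _) (hd _ _), hφ.apply_base]
    rfl
  · obtain ⟨K, hK, hb⟩ := hφ.bound
    refine ⟨Real.exp (K * 1), fun s hs => (hb s _).trans ?_⟩
    gcongr

variable [IsManifold 𝓘(ℝ, E) 1 M]

theorem chartDeriv_self (σ : M) (v : TangentSpace 𝓘(ℝ, E) σ) : chartDeriv E σ σ v = v := by
  rw [chartDeriv_eq_tangentCoordChange (mem_extChartAt_source σ)]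
  exact tangentCoordChange_self (mem_extChartAt_source σ)

theorem exists_chartDeriv_eq {y : M} (hy : y ∈ (extChartAt 𝓘(ℝ, E) σ).source) (v : E) :
    ∃ w, chartDeriv E σ y w = v :=
  (isInvertible_mfderiv_extChartAt (I := 𝓘(ℝ, E)) hy).bijective.surjective v

/-- A limit in the tangent bundle can be read in the chart. -/
theorem tendsto_chartDeriv {ι : Type*} {l : Filter ι} {y : ι → M}
    {w : (i : ι) → TangentSpace 𝓘(ℝ, E) (y i)} {u : TangentSpace 𝓘(ℝ, E) σ}
    (h : Tendsto (fun i => (⟨y i, w i⟩ : TangentBundle 𝓘(ℝ, E) M)) l (𝓝 ⟨σ, u⟩)) :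
    Tendsto (fun i => chartDeriv E σ (y i) (w i)) l (𝓝 u) := by
  have hcd : ∀ y : M, y ∈ (chartAt E σ).source → ∀ v : TangentSpace 𝓘(ℝ, E) y,
      (trivializationAt E (fun x : M => TangentSpace 𝓘(ℝ, E) x) σ ⟨y, v⟩).2 =
        chartDeriv E σ y v := by
    intro y hy v
    have h1 := DFunLike.congr_fun (TangentBundle.continuousLinearMapAt_trivializationAt
      (I := 𝓘(ℝ, E)) hy) v
    refine Eq.trans ?_ h1
    rw [Trivialization.continuousLinearMapAt_apply, Trivialization.coe_linearMapAt_of_mem]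
    rw [TangentBundle.trivializationAt_baseSet]
    exact hy
  have hcont := (trivializationAt E (fun x : M => TangentSpace 𝓘(ℝ, E) x) σ).continuousAt
    (x := ⟨σ, u⟩) (by simp)
  have h2 : Tendsto
      (fun i => (trivializationAt E (fun x : M => TangentSpace 𝓘(ℝ, E) x) σ ⟨y i, w i⟩).2) l
      (𝓝 (trivializationAt E (fun x : M => TangentSpace 𝓘(ℝ, E) x) σ ⟨σ, u⟩).2) :=
    (continuousAt_snd.comp hcont).tendsto.comp h
  have h3 : (trivializationAt E (fun x : M => TangentSpace 𝓘(ℝ, E) x) σ ⟨σ, u⟩).2 = u := by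
    rw [hcd σ (mem_chart_source E σ), chartDeriv_self]
  have hy : Tendsto y l (𝓝 σ) :=
    (FiberBundle.continuous_proj E (fun x : M => TangentSpace 𝓘(ℝ, E) x)).continuousAt.tendsto.comp h
  rw [h3] at h2
  refine h2.congr' ?_
  filter_upwards [hy.eventually (chart_source_mem_nhds E σ)] with i hi
  exact hcd _ hi _

variable [RiemannianBundle (fun x : M => TangentSpace 𝓘(ℝ, E) x)]
  [IsContinuousRiemannianBundle E (fun x : M => TangentSpace 𝓘(ℝ, E) x)]

theorem exists_norm_direction_bounds (σ : M) :
    ∃ κ > (0 : ℝ), ∀ᶠ y in 𝓝 σ, X y ≠ 0 → ‖chartDeriv E σ y (‖X y‖⁻¹ • X y)‖ ≤ κ ∧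
      1 ≤ κ * ‖chartDeriv E σ y (‖X y‖⁻¹ • X y)‖ := by
  obtain ⟨κ, hκ, h⟩ := exists_norm_chartDeriv_bounds (E := E) σ
  refine ⟨κ, hκ, ?_⟩
  filter_upwards [h] with y hy hXy
  have h1 := hy (‖X y‖⁻¹ • X y)
  have h2 : ‖‖X y‖⁻¹ • X y‖ = 1 := by
    rw [norm_smul, norm_inv, norm_norm, inv_mul_cancel₀ (norm_ne_zero_iff.2 hXy)]
  rwa [h2, mul_one] at h1

theorem ne_zero_of_tendsto_direction {ι : Type*} {l : Filter ι} [l.NeBot] {y : ι → M}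
    (hy : Tendsto y l (𝓝 σ)) (hX : ∀ i, X (y i) ≠ 0) {u : E}
    (hu : Tendsto (fun i => chartDeriv E σ (y i) (‖X (y i)‖⁻¹ • X (y i))) l (𝓝 u)) : u ≠ 0 := by
  obtain ⟨κ, hκ, h⟩ := exists_norm_direction_bounds (X := X) σ
  have h1 : 1 ≤ κ * ‖u‖ := by
    refine ge_of_tendsto (hu.norm.const_mul κ) ?_
    filter_upwards [hy.eventually h] with i hi using (hi (hX i)).2
  rintro rfl
  rw [norm_zero, mul_zero] at h1
  linarith

variable [FiniteDimensional ℝ E] [T2Space M] [CompactSpace M]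

/-- The limit directions of `X` at contracted points span attracting lines of the tangent flow. -/
theorem IsLocalFlowModel.exists_isAttractingLine (hφ : IsLocalFlowModel X σ φ)
    (hX : ContMDiff 𝓘(ℝ, E) 𝓘(ℝ, E).tangent 1
      (fun x => (⟨x, X x⟩ : TangentBundle 𝓘(ℝ, E) M))) (C : ℝ) {η T : ℝ} (hη : 0 < η) :
    ∃ K : ℝ, 0 ≤ K ∧ ∀ {ι : Type} {l : Filter ι} [l.NeBot] {y : ι → M} {u : E},
      Tendsto y l (𝓝 σ) → (∀ i, IsContracted X C η T (y i)) →
      Tendsto (fun i => chartDeriv E σ (y i) (‖X (y i)‖⁻¹ • X (y i))) l (𝓝 u) →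
      IsAttractingLine (fun t => fderiv ℝ (φ t) (extChartAt 𝓘(ℝ, E) σ σ)) K η u := by
  obtain ⟨B, hB, hdecay⟩ := hφ.exists_contractsBy_exp hX C (T := T) hη
  obtain ⟨κ, hκ, hκy⟩ := exists_norm_chartDeriv_bounds (E := E) σ
  -- The three factors `κ` convert between chart and Riemannian norms: for the difference, for `v`,
  -- and for the image of the direction.
  refine ⟨κ * B * κ * κ, by positivity, fun {ι l _ y u} hy hc hu t ht v => ?_⟩
  have hu0 : u ≠ 0 := ne_zero_of_tendsto_direction hy (fun i => (hc i).1) hu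
  have hD : Tendsto (fun i => fderiv ℝ (φ t) (extChartAt 𝓘(ℝ, E) σ (y i))) l
      (𝓝 (fderiv ℝ (φ t) (extChartAt 𝓘(ℝ, E) σ σ))) :=
    (((hφ.contDiff t).continuous_fderiv one_ne_zero).tendsto _).comp
      ((continuousAt_extChartAt σ).tendsto.comp hy)
  have hDv : Tendsto (fun i => fderiv ℝ (φ t) (extChartAt 𝓘(ℝ, E) σ (y i)) v) l
      (𝓝 (fderiv ℝ (φ t) (extChartAt 𝓘(ℝ, E) σ σ) v)) :=
    (isBoundedBilinearMap_apply.continuous.tendsto _).comp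
      (hD.prodMk_nhds (tendsto_const_nhds (x := v)))
  have hDu : Tendsto (fun i => fderiv ℝ (φ t) (extChartAt 𝓘(ℝ, E) σ (y i))
      (chartDeriv E σ (y i) (‖X (y i)‖⁻¹ • X (y i)))) l
      (𝓝 (fderiv ℝ (φ t) (extChartAt 𝓘(ℝ, E) σ σ) u)) :=
    (isBoundedBilinearMap_apply.continuous.tendsto _).comp (hD.prodMk_nhds hu)
  refine exists_norm_sub_smul_le_of_tendsto hDv hDu
    (((hDu.norm).const_mul (κ * B * κ * κ * Real.exp (-η * t))).mul_const ‖v‖)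
    (hφ.isLinearFlow.apply_ne_zero t hu0) ?_
  have habs : |t| ≤ t := (abs_of_nonneg ht).le
  filter_upwards [hy.eventually (hdecay t ht), hy.eventually hκy,
    hy.eventually (hφ.eventually_mem t _ hκy), hy.eventually (hφ.eventually_chartDeriv t),
    hy.eventually (hφ.eventually_mdifferentiableAt t),
    hy.eventually (extChartAt_source_mem_nhds (I := 𝓘(ℝ, E)) σ)] with i h1 h2 h3 h4 h5 h6
  obtain ⟨w, hw⟩ := exists_chartDeriv_eq h6 v
  have hXpos : 0 < ‖X (y i)‖ := norm_pos_iff.2 (hc i).1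
  have h7 := h1 (hc i) w
  set d := ‖X (y i)‖⁻¹ • X (y i) with hd
  -- This turns the ratio of the norms of `X` into the norm of the image of the unit direction `d`.
  have hdir : X (flow X t (y i)) = ‖X (y i)‖ • tangentFlow X t (y i) d := by
    rw [hd, map_smul, tangentFlow_self hX (h5 t habs), smul_smul, mul_inv_cancel₀ hXpos.ne',
      one_smul]
  set a := inner ℝ (tangentFlow X t (y i) w) (X (flow X t (y i))) / ‖X (flow X t (y i))‖ ^ 2 with ha
  have h8 : transversalNorm X (flow X t (y i)) (tangentFlow X t (y i) w) =
      ‖tangentFlow X t (y i) (w - (a * ‖X (y i)‖) • d)‖ := by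
    rw [transversalNorm, ← ha, map_sub, map_smul, mul_smul, ← hdir]
  have h9 : ‖tangentFlow X t (y i) (w - (a * ‖X (y i)‖) • d)‖ ≤
      B * Real.exp (-η * t) * ‖w‖ * ‖tangentFlow X t (y i) d‖ := by
    rw [h8, hdir, norm_smul, norm_norm] at h7
    have h10 := transversalNorm_le_norm (X := X) (y i) w
    refine le_of_mul_le_mul_right ?_ hXpos
    calc _ ≤ _ := h7
      _ ≤ B * Real.exp (-η * t) * ‖w‖ * (‖X (y i)‖ * ‖tangentFlow X t (y i) d‖) := by gcongr
      _ = _ := by ring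
  refine ⟨a * ‖X (y i)‖, ?_⟩
  have h11 := (h3 t habs (tangentFlow X t (y i) (w - (a * ‖X (y i)‖) • d))).1
  have h12 := (h3 t habs (tangentFlow X t (y i) d)).2
  rw [h4 t habs] at h11 h12
  have h13 := (h2 w).2
  rw [hw] at h13
  have h14 : chartDeriv E σ (y i) (w - (a * ‖X (y i)‖) • d) =
      v - (a * ‖X (y i)‖) • chartDeriv E σ (y i) d := by
    rw [map_sub, map_smul, hw]
  rw [h14, map_sub, map_smul] at h11
  calc _ ≤ κ * ‖tangentFlow X t (y i) (w - (a * ‖X (y i)‖) • d)‖ := h11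
    _ ≤ κ * (B * Real.exp (-η * t) * (κ * ‖v‖) *
        (κ * ‖fderiv ℝ (φ t) (extChartAt 𝓘(ℝ, E) σ (y i)) (chartDeriv E σ (y i) d)‖)) := by
        gcongr
        refine h9.trans ?_
        gcongr
    _ = _ := by ring

end Limit

/-! ### Transfer of the splitting to the tangent flow -/

section Singularity

variable {E : Type*} [NormedAddCommGroup E] [NormedSpace ℝ E]
  {M : Type*} [TopologicalSpace M] [ChartedSpace E M] [IsManifold 𝓘(ℝ, E) 1 M]
  [FiniteDimensional ℝ E] [T2Space M] [CompactSpace M]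
  {X : (x : M) → TangentSpace 𝓘(ℝ, E) x} {σ : M} {φ : ℝ → E → E}

theorem IsLocalFlowModel.tangentFlow_apply (hφ : IsLocalFlowModel X σ φ)
    (hX : ContMDiff 𝓘(ℝ, E) 𝓘(ℝ, E).tangent 1
      (fun x => (⟨x, X x⟩ : TangentBundle 𝓘(ℝ, E) M))) (hσ : X σ = 0) (t : ℝ) (v : E) :
    (tangentFlow X t σ v : E) = fderiv ℝ (φ t) (extChartAt 𝓘(ℝ, E) σ σ) v := by
  have : CompleteSpace E := FiniteDimensional.complete ℝ E
  have h1 := (hφ.eventually_chartDeriv |t|).self_of_nhds t le_rfl v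
  have h2 : ∀ z : M, z = σ → ∀ w : TangentSpace 𝓘(ℝ, E) z, chartDeriv E σ z w = (w : E) := by
    rintro _ rfl w
    exact chartDeriv_self _ w
  rw [h2 _ (flow_eq_self_of_eq_zero hX hσ t)] at h1
  exact h1.trans (congrArg _ (chartDeriv_self σ v))

variable [RiemannianBundle (fun x : M => TangentSpace 𝓘(ℝ, E) x)]
  [IsContinuousRiemannianBundle E (fun x : M => TangentSpace 𝓘(ℝ, E) x)]

/-- A dominated splitting of the linear flow at `σ` is one of the tangent flow. -/
theorem IsLocalFlowModel.isDominatedSplitting (hφ : IsLocalFlowModel X σ φ)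
    (hX : ContMDiff 𝓘(ℝ, E) 𝓘(ℝ, E).tangent 1
      (fun x => (⟨x, X x⟩ : TangentBundle 𝓘(ℝ, E) M))) (hσ : X σ = 0) {V W : Submodule ℝ E}
    (hc : IsCompl V W)
    (hV : ∀ t, V.map (fderiv ℝ (φ t) (extChartAt 𝓘(ℝ, E) σ σ)).toLinearMap = V)
    (hW : ∀ t, W.map (fderiv ℝ (φ t) (extChartAt 𝓘(ℝ, E) σ σ)).toLinearMap = W)
    {η : ℝ} (hη : 0 < η)
    (hdom : ∃ L > (0 : ℝ), ∀ t : ℝ, 0 ≤ t → ∀ v ∈ V, ∀ w ∈ W,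
      ‖fderiv ℝ (φ t) (extChartAt 𝓘(ℝ, E) σ σ) v‖ * ‖w‖ ≤
        L * Real.exp (-η * t) * (‖v‖ * ‖fderiv ℝ (φ t) (extChartAt 𝓘(ℝ, E) σ σ) w‖)) :
    IsDominatedSplitting X {σ} (fun _ => V) (fun _ => W) := by
  have : CompleteSpace E := FiniteDimensional.complete ℝ E
  have htf := hφ.tangentFlow_apply hX hσ
  refine ⟨?_, ?_, ?_, ?_⟩
  · rintro _ rfl
    exact hc
  · rintro _ rfl t
    refine Eq.trans ?_ (hV t)
    refine SetLike.ext fun v => ⟨?_, ?_⟩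
    · rintro ⟨w, hw, rfl⟩
      exact ⟨w, hw, (htf t w).symm⟩
    · rintro ⟨w, hw, rfl⟩
      exact ⟨w, hw, htf t w⟩
  · rintro _ rfl t
    refine Eq.trans ?_ (hW t)
    refine SetLike.ext fun v => ⟨?_, ?_⟩
    · rintro ⟨w, hw, rfl⟩
      exact ⟨w, hw, (htf t w).symm⟩
    · rintro ⟨w, hw, rfl⟩
      exact ⟨w, hw, htf t w⟩
  · obtain ⟨L, hL, hLb⟩ := hdom
    obtain ⟨κ, hκ, hκy⟩ := exists_norm_chartDeriv_bounds (E := E) σ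
    have hκσ := hκy.self_of_nhds
    -- The same vectors carry the norm of `E` and the Riemannian norm; each of the four norms in the
    -- inequality is converted once.
    refine ⟨κ ^ 4 * L, by positivity, η, hη, ?_⟩
    rintro y hy t ht v hv w hw
    obtain rfl : y = σ := hy
    have h1 : ∀ z : M, z = y → ∀ a : TangentSpace 𝓘(ℝ, E) z, ∀ b : E, (a : E) = b →
        ‖a‖ ≤ κ * ‖b‖ ∧ ‖b‖ ≤ κ * ‖a‖ := by
      rintro z rfl a b rfl
      have := hκσ a
      rw [chartDeriv_self] at this
      exact ⟨this.2, this.1⟩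
    have h2 := (h1 _ (flow_eq_self_of_eq_zero hX hσ t) _ _ (htf t v)).1
    have h3 := (h1 _ (flow_eq_self_of_eq_zero hX hσ t) _ _ (htf t w)).2
    have h4 := (h1 _ rfl v _ rfl).2
    have h5 := (h1 _ rfl w _ rfl).1
    have h6 := hLb t ht v hv w hw
    set Ψ := fderiv ℝ (φ t) (extChartAt 𝓘(ℝ, E) y y)
    calc ‖tangentFlow X t y v‖ * ‖w‖ ≤ (κ * @norm E _ (Ψ v)) * (κ * @norm E _ w) := by gcongr
      _ = κ * κ * (@norm E _ (Ψ v) * @norm E _ w) := by ring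
      _ ≤ κ * κ * (L * Real.exp (-η * t) * (@norm E _ v * @norm E _ (Ψ w))) := by gcongr
      _ ≤ κ * κ * (L * Real.exp (-η * t) * ((κ * ‖v‖) * (κ * ‖tangentFlow X t y w‖))) := by gcongr
      _ = _ := by ring

end Singularity

end VectorFieldFlow

end

/-! ### The proposition -/

open VectorFieldFlow in
theorem mainTheorem2
    {E : Type*} [NormedAddCommGroup E] [NormedSpace ℝ E] [FiniteDimensional ℝ E]
    {M : Type*} [TopologicalSpace M] [T2Space M] [CompactSpace M] [ChartedSpace E M]
    [IsManifold 𝓘(ℝ, E) ∞ M]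
    [RiemannianBundle (fun x : M => TangentSpace 𝓘(ℝ, E) x)]
    [IsContMDiffRiemannianBundle 𝓘(ℝ, E) ∞ E (fun x : M => TangentSpace 𝓘(ℝ, E) x)]
    (X : (x : M) → TangentSpace 𝓘(ℝ, E) x)
    (hX : ContMDiff 𝓘(ℝ, E) 𝓘(ℝ, E).tangent 1
      (fun x => (⟨x, X x⟩ : TangentBundle 𝓘(ℝ, E) M)))
    (C η T : ℝ) (hC : 0 < C) (hη : 0 < η) (hT : 0 < T)
    (σ : M) (hσ : X σ = 0)
    (x : ℕ → M) (hx : ∀ n, IsContracted X C η T (x n)) (hxσ : Tendsto x atTop (𝓝 σ)) :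
    ∃ V W : (y : M) → Submodule ℝ (TangentSpace 𝓘(ℝ, E) y),
      IsDominatedSplitting X {σ} V W ∧
      Module.finrank ℝ (W σ) = 1 ∧
      ∀ u : TangentSpace 𝓘(ℝ, E) σ,
        MapClusterPt (⟨σ, u⟩ : TangentBundle 𝓘(ℝ, E) M) atTop
          (fun n => (⟨x n, ‖X (x n)‖⁻¹ • X (x n)⟩ : TangentBundle 𝓘(ℝ, E) M)) →
        u ∉ V σ := by
  have hcont : IsContinuousRiemannianBundle E (fun x : M => TangentSpace 𝓘(ℝ, E) x) := by
    obtain ⟨g, hg, hgi⟩ := IsContMDiffRiemannianBundle.exists_contMDiff (IB := 𝓘(ℝ, E)) (n := ∞)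
      (F := E) (E := fun x : M => TangentSpace 𝓘(ℝ, E) x)
    exact ⟨g, hg.continuous, hgi⟩
  obtain ⟨φ, hφ⟩ := exists_isLocalFlowModel hX hσ
  obtain ⟨K, hK, hline⟩ := hφ.exists_isAttractingLine hX C (T := T) hη
  have hX0 : ∀ n, X (x n) ≠ 0 := fun n => (hx n).1
  obtain ⟨κ, -, hκ⟩ := exists_norm_direction_bounds (X := X) σ
  -- The splitting is built from one limit direction `u₀`, which exists by compactness; a free
  -- ultrafilter replaces the choice of a subsequence.
  obtain ⟨u₀, hu₀⟩ : ∃ u₀ : E, Tendsto (fun n => chartDeriv E σ (x n) (‖X (x n)‖⁻¹ • X (x n)))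
      (hyperfilter ℕ) (𝓝 u₀) := by
    have hle : ((hyperfilter ℕ).map fun n => chartDeriv E σ (x n) (‖X (x n)‖⁻¹ • X (x n)) :
        Filter E) ≤ 𝓟 (Metric.closedBall 0 κ) := by
      refine le_principal_iff.2 (Nat.hyperfilter_le_atTop ?_)
      filter_upwards [hxσ.eventually hκ] with n hn
      exact mem_closedBall_zero_iff.2 (hn (hX0 n)).1
    obtain ⟨u₀, -, h⟩ := (isCompact_closedBall (0 : E) κ).ultrafilter_le_nhds _ hle
    exact ⟨u₀, h⟩
  have hxh := hxσ.mono_left Nat.hyperfilter_le_atTop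
  have hu₀0 := ne_zero_of_tendsto_direction hxh hX0 hu₀
  have hflow := hφ.isLinearFlow
  obtain ⟨F, hF, hF1, hFinv, hdom⟩ :=
    hflow.exists_dominated_complement hη hu₀0 hK (hline hxh hx hu₀)
  refine ⟨_, _, hφ.isDominatedSplitting hX hσ hF hflow.map_slowSubmodule hFinv hη hdom, hF1,
    fun u hu => ?_⟩
  -- An arbitrary accumulation direction is a limit along another ultrafilter, hence also spans an
  -- attracting line, and is compared with `u₀`.
  obtain ⟨G, hG, hGu⟩ := mapClusterPt_iff_ultrafilter.1 hu
  have hxG := hxσ.mono_left hG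
  have huG := tendsto_chartDeriv hGu
  exact hflow.notMem_slowSubmodule_of_isAttractingLine hη
    (ne_zero_of_tendsto_direction hxG hX0 huG) hK (hline hxG hx huG)
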